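/- A 1-weighted game structure $G=(V_1,V_2,E,w)$ consists of a finite non-empty directed graph $(V,E)$ without deadlocks (every vertex has a successor), a partition $V=V_1\cup V_2$ into the vertices of player 1 and of player 2, and weights $w:E\to\mathbb Z$. Let $W=\max(1,\max_{e\in E}|w(e)|)$. For a window size $\lambda\ge 1$ and $U\subseteq V$, let $\mathsf{WMP}(\lambda,0)$ be the set of plays $\rho$ such that for every $k\ge 0$ there is $l\in\{1,\dots,\lambda\}$ with $\frac1l\sum_{i=k}^{k+l-1}w(\rho_i,\rho_{i+1})\ge 0$; let $\mathsf{Reach}(U)$ (resp. $\mathsf{Buchi}(U)$) be the set of plays that visit $U$ at least once (resp. infinitely often). Let $\Omega=\mathsf{WMP}(\lambda,0)\cap\mathsf{Buchi}(U)$ be the objective of player 1; the objective of player 2 is its complement. A vertex is winning for a player if he has a strategy from it that ensures his objective. The memory of a finite-memory strategy is the number of states of a deterministic Moore machine that encodes it. Put $Y_0=\emptyset$ and, for $k\ge 0$, let $X_k$ be the winning set of player 1 for $\mathsf{WMP}(\lambda,0)\cap\mathsf{Reach}(U)$ in the subgame of $G$ induced by $V\setminus Y_k$, and let $Y_{k+1}$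 be the $2$-attractor of $V\setminus X_k$ in $G$, i.e. the set of vertices from which player 2 can force a visit to $V\setminus X_k$, obtained by the usual inductive construction. (The sets $V\setminus Y_k$ do induce subgames.) Then: 1. there is a first index $k^*$ with $X_{k^*}=V\setminus Y_{k^*}$ or $X_{k^*}=\emptyset$; it satisfies $k^*\le |V|$, the set $X_{k^*}$ is the winning set of player 1 for $\Omega$ in $G$, and $V\setminus X_{k^*}$ is the winning set of player 2 for the complement of $\Omega$; 2. the winning set of player 1 for $\Omega$ can be computed in $O(\lambda\cdot|V|^2\cdot(|V|+|E|)\cdot\max(1,\lceil\log_2(\lambda W)\rceil))$ time, on a random access machine where elementary operations on vertices, edges and addresses take unit time and elementary operations on numbers (weights, sums of weights, $\lambda$) take time linear in the number of their bits; 3. from each vertex that is winning for player 1 (resp. player 2), that player has a finite-memory winning strategy with memory in $O(\lambda^2 W|V|)$ (resp. $O(\lambda^2W|V|^2)$). The constants hidden in the $O$'s are absolute. -/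

import Mathlib

/-! ## Weighted two-player game structures -/

/-- The two players. -/
inductive Player where
  | one
  | two

/-- The opponent of a player. -/
def Player.opp : Player → Player
  | .one => .two
  | .two => .one

/-- A 1-weighted two-player game structure on the vertex set `V`: the edge set `E`, the partition
of `V` into the vertices of the two players (`owner`), the integer weights of the edges (only the
values of `w` on `E` are ever used), and no deadlock. -/
structure Game (V : Type*) where
  owner : V → Player
  E : Set (V × V)
  w : V → V → ℤ
  no_deadlock : ∀ v, ∃ v', (v, v') ∈ E

namespace Game

variable {V : Type*} (G : Game V)

/-- `max(1, W)`, where `W` is the maximal absolute value of a weight of an edge. -/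
noncomputable def maxWeight : ℕ :=
  max 1 (sSup ((fun e : V × V => (G.w e.1 e.2).natAbs) '' G.E))

/-- Plays are infinite paths. -/
def IsPlay (ρ : ℕ → V) : Prop := ∀ k, (ρ k, ρ (k + 1)) ∈ G.E

/-- A strategy of player `p`: `σ h v` is the vertex chosen after the history `h v`
(the values at vertices `v` that `p` does not own are irrelevant). -/
structure Strategy (p : Player) where
  toFun : List V → V → V
  valid : ∀ h v, G.owner v = p → (v, toFun h v) ∈ G.E

/-- The history after `k` steps when both players follow their strategies from `v₀`, split into
the sequence of the first `k` vertices and the current vertex. -/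
def outHist (v₀ : V) (σ₁ : G.Strategy .one) (σ₂ : G.Strategy .two) : ℕ → List V × V
  | 0 => ([], v₀)
  | k + 1 =>
    let h := (outHist v₀ σ₁ σ₂ k).1
    let v := (outHist v₀ σ₁ σ₂ k).2
    (h ++ [v], match G.owner v with
      | .one => σ₁.toFun h v
      | .two => σ₂.toFun h v)

/-- The outcome of a pair of strategies from `v₀`. -/
def out (v₀ : V) (σ₁ : G.Strategy .one) (σ₂ : G.Strategy .two) (k : ℕ) : V :=
  (G.outHist v₀ σ₁ σ₂ k).2

/-- `σ₁` is a winning strategy of player 1 from `v₀` for the objective `Ω`. -/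
def Wins₁ (Ω : Set (ℕ → V)) (v₀ : V) (σ₁ : G.Strategy .one) : Prop :=
  ∀ σ₂ : G.Strategy .two, G.out v₀ σ₁ σ₂ ∈ Ω

/-- `σ₂` is a winning strategy of player 2 from `v₀` for the complement of the objective `Ω`. -/
def Wins₂ (Ω : Set (ℕ → V)) (v₀ : V) (σ₂ : G.Strategy .two) : Prop :=
  ∀ σ₁ : G.Strategy .one, G.out v₀ σ₁ σ₂ ∉ Ω

/-- The winning set of player 1 for the objective `Ω`. -/
def Win₁ (Ω : Set (ℕ → V)) : Set V := {v | ∃ σ₁, G.Wins₁ Ω v σ₁}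

/-- The winning set of player 2 for the complement of the objective `Ω`. -/
def Win₂ (Ω : Set (ℕ → V)) : Set V := {v | ∃ σ₂, G.Wins₂ Ω v σ₂}

/-! ### Finite-memory strategies -/

/-- A Moore machine with state set `M`, reading vertices. -/
structure Moore (V M : Type*) where
  init : M
  update : M → V → M
  next : M → V → V

/-- The strategy `σ` of player `p` is encoded by a Moore machine with at most `N` states. -/
def Strategy.HasMemory {G : Game V} {p : Player} (σ : G.Strategy p) (N : ℕ) : Prop :=
  ∃ (M : Type) (_ : Finite M) (A : Moore V M), Nat.card M ≤ N ∧
    ∀ h v, G.owner v = p → σ.toFun h v = A.next (h.foldl A.update A.init) v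

/-! ### Objectives -/

/-- The total payoff of the factor of `ρ` from position `k` to position `k + l`. -/
def TP (ρ : ℕ → V) (k l : ℕ) : ℤ :=
  ∑ i ∈ Finset.range l, G.w (ρ (k + i)) (ρ (k + i + 1))

/-- The mean payoff of the factor of `ρ` from position `k` to position `k + l`. -/
def MP (ρ : ℕ → V) (k l : ℕ) : ℚ := (G.TP ρ k l : ℚ) / (l : ℚ)

/-- The window mean-payoff objective `WMP(lam, ≥ ν)`. -/
def WMP (lam : ℕ) (ν : ℚ) : Set (ℕ → V) :=
  {ρ | G.IsPlay ρ ∧ ∀ k, ∃ l, 1 ≤ l ∧ l ≤ lam ∧ ν ≤ G.MP ρ k l}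

/-- Reachability: some vertex of `U` is visited. -/
def Reach (U : Set V) : Set (ℕ → V) := {ρ | G.IsPlay ρ ∧ ∃ k, ρ k ∈ U}

/-- Büchi: vertices of `U` are visited infinitely often (equivalently, as `V` is finite,
some vertex of `U` is). -/
def Buchi (U : Set V) : Set (ℕ → V) := {ρ | G.IsPlay ρ ∧ ∀ n, ∃ k, n ≤ k ∧ ρ k ∈ U}

/-! ### Closed sets, subgames and attractors -/

/-- `X` is `p`-closed: player `p` cannot leave `X` and his opponent can stay in `X`. -/
def IsClosed (p : Player) (X : Set V) : Prop :=
  (∀ v ∈ X, G.owner v = p → ∀ v', (v, v') ∈ G.E → v' ∈ X) ∧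
  (∀ v ∈ X, G.owner v = p.opp → ∃ v' ∈ X, (v, v') ∈ G.E)

/-- The subgame structure induced by a `p`-closed set. -/
def induce (p : Player) (X : Set V) (h : G.IsClosed p X) : Game X where
  owner v := G.owner v
  E := {e | ((e.1 : V), (e.2 : V)) ∈ G.E}
  w u v := G.w u v
  no_deadlock := by
    rintro ⟨v, hv⟩
    by_cases hp : G.owner v = p
    · obtain ⟨v', hv'⟩ := G.no_deadlock v
      exact ⟨⟨v', h.1 v hv hp v' hv'⟩, hv'⟩
    · have hp' : G.owner v = p.opp := by
        revert hp
        cases G.owner v <;> cases p <;> simp [Player.opp]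
      obtain ⟨v', hv', he⟩ := h.2 v hv hp'
      exact ⟨⟨v', hv'⟩, he⟩

/-- The `k`-th stage of the `p`-attractor of `U`. -/
def attrStage (p : Player) (U : Set V) : ℕ → Set V
  | 0 => U
  | k + 1 => attrStage p U k ∪
      {v | G.owner v = p ∧ ∃ v', (v, v') ∈ G.E ∧ v' ∈ attrStage p U k} ∪
      {v | G.owner v = p.opp ∧ ∀ v', (v, v') ∈ G.E → v' ∈ attrStage p U k}

/-- The `p`-attractor of `U`. -/
def attr (p : Player) (U : Set V) : Set V := ⋃ k, G.attrStage p U k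

theorem attrStage_mono (p : Player) (U : Set V) : Monotone (G.attrStage p U) :=
  monotone_nat_of_le_succ fun _ _ hv => Or.inl (Or.inl hv)

theorem isClosed_compl_attr [Finite V] (p : Player) (U : Set V) :
    G.IsClosed p (G.attr p U)ᶜ := by
  constructor
  · intro v hv hp v' he hv'
    obtain ⟨k, hk⟩ := Set.mem_iUnion.1 hv'
    exact hv (Set.mem_iUnion.2 ⟨k + 1, Or.inl (Or.inr ⟨hp, v', he, hk⟩)⟩)
  · intro v hv hp
    by_contra! hc
    have h1 : ∀ v', ∃ k, (v, v') ∈ G.E → v' ∈ G.attrStage p U k := by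
      intro v'
      by_cases he : (v, v') ∈ G.E
      · have : v' ∈ G.attr p U := by
          by_contra hn
          exact hc v' hn he
        obtain ⟨k, hk⟩ := Set.mem_iUnion.1 this
        exact ⟨k, fun _ => hk⟩
      · exact ⟨0, fun h => absurd h he⟩
    choose f hf using h1
    obtain ⟨K, hK⟩ := (Set.finite_range f).bddAbove
    refine hv (Set.mem_iUnion.2 ⟨K + 1, Or.inr ⟨hp, fun v' he => ?_⟩⟩)
    exact G.attrStage_mono p U (hK ⟨v', rfl⟩) (hf v' he)

theorem isClosed_compl_empty (p : Player) : G.IsClosed p (∅ : Set V)ᶜ := by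
  constructor
  · intro v _ _ v' _
    simp
  · intro v _ _
    obtain ⟨v', hv'⟩ := G.no_deadlock v
    exact ⟨v', by simp, hv'⟩

/-! ### The iteration of losing sets and attractors -/

/-- The set of vertices of the subgame induced by the `2`-closed set `X` from which player 1 wins
the objective `WMP(lam, 0) ∩ Reach(U)` in this subgame. -/
def wmpReach (U : Set V) (lam : ℕ) (X : Set V) (h : G.IsClosed .two X) : Set V :=
  Subtype.val '' (G.induce .two X h).Win₁
    ((G.induce .two X h).WMP lam 0 ∩ (G.induce .two X h).Reach (Subtype.val ⁻¹' U))

/-- The removed sets `Y₀ = ∅`, `Y_{k+1} = Attr₂(V \ X_k)`, where `X_k` is the winning set for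
`WMP(lam, 0) ∩ Reach(U)` in the subgame induced by `V \ Y_k`. -/
def removed [Finite V] (U : Set V) (lam : ℕ) : ℕ → {Y : Set V // G.IsClosed .two Yᶜ}
  | 0 => ⟨∅, G.isClosed_compl_empty .two⟩
  | k + 1 =>
    let Y := removed U lam k
    ⟨G.attr .two (G.wmpReach U lam Y.1ᶜ Y.2)ᶜ, G.isClosed_compl_attr .two _⟩

/-- The sets `X_k`. -/
def candidate [Finite V] (U : Set V) (lam : ℕ) (k : ℕ) : Set V :=
  G.wmpReach U lam (G.removed U lam k).1ᶜ (G.removed U lam k).2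

/-- The stopping criterion of the iteration: `X_k = V \ Y_k` or `X_k = ∅`. -/
def Stops [Finite V] (U : Set V) (lam : ℕ) (k : ℕ) : Prop :=
  G.candidate U lam k = (G.removed U lam k).1ᶜ ∨ G.candidate U lam k = ∅

end Game

/-! ## A random access machine with costs

Programs of a small imperative language with two sorts of data. *Indices* (natural numbers, used
for vertices, edges and addresses) admit only copying, constants, successor, predecessor and
comparison, each at unit cost. *Numbers* (integers) admit copying, constants, addition, negation
and comparison, at a cost that is linear in the number of bits of the values involved. Both sorts
have registers and arrays; arrays are addressed by indices. -/

namespace Ram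

/-- A memory state. -/
structure State where
  ireg : ℕ → ℕ
  iarr : ℕ → ℕ → ℕ
  zreg : ℕ → ℤ
  zarr : ℕ → ℕ → ℤ

/-- Index expressions. -/
inductive IExp where
  | const (n : ℕ)
  | reg (x : ℕ)
  | arr (a : ℕ) (i : IExp)
  | succ (e : IExp)
  | pred (e : IExp)

/-- Value of an index expression. -/
def IExp.val (s : State) : IExp → ℕ
  | .const n => n
  | .reg x => s.ireg x
  | .arr a i => s.iarr a (i.val s)
  | .succ e => e.val s + 1
  | .pred e => e.val s - 1

/-- Evaluation cost of an index expression. -/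
def IExp.cost : IExp → ℕ
  | .const _ => 1
  | .reg _ => 1
  | .arr _ i => i.cost + 1
  | .succ e => e.cost + 1
  | .pred e => e.cost + 1

/-- Number expressions. -/
inductive ZExp where
  | const (z : ℤ)
  | reg (x : ℕ)
  | arr (a : ℕ) (i : IExp)
  | plus (e f : ZExp)
  | neg (e : ZExp)

/-- Value of a number expression. -/
def ZExp.val (s : State) : ZExp → ℤ
  | .const z => z
  | .reg x => s.zreg x
  | .arr a i => s.zarr a (i.val s)
  | .plus e f => e.val s + f.val s
  | .neg e => - e.val s

/-- One more than the number of binary digits of `|z|`. -/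
def bitCost (z : ℤ) : ℕ := Nat.size z.natAbs + 1

/-- Evaluation cost of a number expression: every operation costs the length of its result
(the lengths of its operands are charged when these are evaluated). -/
def ZExp.cost (s : State) : ZExp → ℕ
  | .const z => bitCost z
  | .reg x => bitCost (s.zreg x)
  | .arr a i => i.cost + bitCost (s.zarr a (i.val s))
  | .plus e f => e.cost s + f.cost s + bitCost (e.val s + f.val s)
  | .neg e => e.cost s + bitCost (e.val s)

/-- Tests. -/
inductive Test where
  | ieq (e f : IExp)
  | ilt (e f : IExp)
  | zle (e f : ZExp)
  | neg (b : Test)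
  | conj (b c : Test)

/-- Truth of a test. -/
def Test.holds (s : State) : Test → Prop
  | .ieq e f => e.val s = f.val s
  | .ilt e f => e.val s < f.val s
  | .zle e f => e.val s ≤ f.val s
  | .neg b => ¬ b.holds s
  | .conj b c => b.holds s ∧ c.holds s

/-- Evaluation cost of a test. -/
def Test.cost (s : State) : Test → ℕ
  | .ieq e f => e.cost + f.cost + 1
  | .ilt e f => e.cost + f.cost + 1
  | .zle e f => e.cost s + f.cost s + 1
  | .neg b => b.cost s + 1
  | .conj b c => b.cost s + c.cost s + 1

/-- Programs. -/
inductive Prog where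
  | skip
  | setI (x : ℕ) (e : IExp)
  | storeI (a : ℕ) (i e : IExp)
  | setZ (x : ℕ) (e : ZExp)
  | storeZ (a : ℕ) (i : IExp) (e : ZExp)
  | seq (c d : Prog)
  | ite (b : Test) (c d : Prog)
  | loop (b : Test) (c : Prog)

/-- `Exec c s s' t`: the program `c`, started in the state `s`, halts in the state `s'` at
cost `t`. -/
inductive Exec : Prog → State → State → ℕ → Prop where
  | skip (s : State) : Exec .skip s s 1
  | setI (s : State) (x : ℕ) (e : IExp) :
      Exec (.setI x e) s { s with ireg := Function.update s.ireg x (e.val s) } (e.cost + 1)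
  | storeI (s : State) (a : ℕ) (i e : IExp) :
      Exec (.storeI a i e) s
        { s with iarr := Function.update s.iarr a
                  (Function.update (s.iarr a) (i.val s) (e.val s)) }
        (i.cost + e.cost + 1)
  | setZ (s : State) (x : ℕ) (e : ZExp) :
      Exec (.setZ x e) s { s with zreg := Function.update s.zreg x (e.val s) } (e.cost s + 1)
  | storeZ (s : State) (a : ℕ) (i : IExp) (e : ZExp) :
      Exec (.storeZ a i e) s
        { s with zarr := Function.update s.zarr a
                  (Function.update (s.zarr a) (i.val s) (e.val s)) }
        (i.cost + e.cost s + 1)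
  | seq {c d : Prog} {s s' s'' : State} {t t' : ℕ} :
      Exec c s s' t → Exec d s' s'' t' → Exec (.seq c d) s s'' (t + t')
  | iteTrue {b : Test} {c d : Prog} {s s' : State} {t : ℕ} :
      b.holds s → Exec c s s' t → Exec (.ite b c d) s s' (b.cost s + t + 1)
  | iteFalse {b : Test} {c d : Prog} {s s' : State} {t : ℕ} :
      ¬ b.holds s → Exec d s s' t → Exec (.ite b c d) s s' (b.cost s + t + 1)
  | loopDone {b : Test} {c : Prog} {s : State} :
      ¬ b.holds s → Exec (.loop b c) s s (b.cost s + 1)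
  | loopStep {b : Test} {c : Prog} {s s' s'' : State} {t t' : ℕ} :
      b.holds s → Exec c s s' t → Exec (.loop b c) s' s'' t' →
      Exec (.loop b c) s s'' (b.cost s + t + t' + 1)

open Classical in
/-- The input state for a game structure `G`, a target set `U` and a window size `lam`, for given
numberings `ev` of the vertices and `ee` of the edges: index registers 0 and 1 hold the numbers of
vertices and edges, number register 0 holds `lam`, the index arrays 0 to 3 hold the owner (1 or 2)
of each vertex, the indicator function of `U`, the source and the target of each edge, and number
array 0 holds the weight of each edge. All other cells are 0. -/
noncomputable def input {V : Type*} (G : Game V) (U : Set V) (lam : ℕ)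
    (ev : Fin (Nat.card V) ≃ V) (ee : Fin G.E.ncard ≃ G.E) : State where
  ireg x := match x with
    | 0 => Nat.card V
    | 1 => G.E.ncard
    | _ => 0
  iarr a i := match a with
    | 0 => if h : i < Nat.card V then
        (match G.owner (ev ⟨i, h⟩) with
          | .one => 1
          | .two => 2) else 0
    | 1 => if h : i < Nat.card V then (if ev ⟨i, h⟩ ∈ U then 1 else 0) else 0
    | 2 => if h : i < G.E.ncard then (ev.symm (ee ⟨i, h⟩).1.1 : ℕ) else 0
    | 3 => if h : i < G.E.ncard then (ev.symm (ee ⟨i, h⟩).1.2 : ℕ) else 0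
    | _ => 0
  zreg x := match x with
    | 0 => (lam : ℤ)
    | _ => 0
  zarr a i := match a with
    | 0 => if h : i < G.E.ncard then G.w (ee ⟨i, h⟩).1.1 (ee ⟨i, h⟩).1.2 else 0
    | _ => 0

/-- The program `P`, given the game structure `G`, the target set `U` and the window size `lam` in
any numbering of vertices and edges, halts at cost at most `T`, and index array 4 then holds the
indicator function of the set `X` of vertices. -/
def Computes {V : Type*} (P : Prog) (G : Game V) (U : Set V) (lam : ℕ) (X : Set V) (T : ℕ) :
    Prop :=
  ∀ (ev : Fin (Nat.card V) ≃ V) (ee : Fin G.E.ncard ≃ G.E), ∃ (s' : State) (t : ℕ),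
    Exec P (input G U lam ev ee) s' t ∧ t ≤ T ∧
      ∀ i : Fin (Nat.card V), (ev i ∈ X → s'.iarr 4 i = 1) ∧ (ev i ∉ X → s'.iarr 4 i = 0)

end Ram

/-!
When the sum over a window becomes nonnegative for the first time, all the windows opened inside it
close as well, so the window objective amounts to closing one window after the other within `lam`
steps. The predicate `Game.Force` is the solution of the game in which player 1 must close the
current windows in a given set `X`, or in a given set `Z` if the window has met `U`; for a set `Z`,
the least fixed point over `X` describes the vertices from which player 1 can, after finitely many
windows, visit `U` and close the window in `Z`. The greatest fixed point over `Z` of this map is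
`Game.winSet`, the winning set of player 1 for `WMP ∩ Buchi`.

Both players win, from this set and from its complement respectively, by maintaining an invariant of
configurations that consist of the current vertex, a flag for `U`, the debt (minus the sum over the
window) and the remaining number of steps (`Game.exists_strategy_one`, `Game.exists_strategy_two`).
Such invariants directly give finite-memory strategies (`Game.exists_strategy_of_invariant`). Player
1 reads off the rank that he has to decrease from the configuration. Player 2 additionally stores
the index of an outer iterate, whence the additional factor `|V|`; this index decreases whenever a
window closes after a visit to `U`.

The sets of the iteration always contain `winSet`: all vertices that player 1 needs for forcing
closings in `winSet` are themselves in `winSet`, so his moves are available in every subgame that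
contains `winSet`. If conversely player 1 wins `WMP ∩ Reach` everywhere in the last subgame, then
the first outer iterate of the subgame is the whole subgame, and the coinduction principle
`Game.subset_winSet` shows that the subgame is contained in `winSet`.

For the running time, `Game.Force` is downward closed in the debt. The greatest debt that can be
paid off satisfies a recursion along the edges, with a maximum at the vertices of player 1 and a
minimum at those of player 2. All numbers involved are bounded by `2 * lam * W`. The program
`Ram.winProg` runs `lam` steps of this dynamic programming inside the two fixed point iterations,
each of which needs at most `|V|` rounds.
-/

/-! ### Strategies from invariants -/

namespace Game

variable {V : Type*} (G : Game V)

/-- The controllable predecessor: player `p` can ensure that the successor of `v` satisfies `P`. -/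
def Cpre (p : Player) (P : V → Prop) (v : V) : Prop :=
  (G.owner v = p → ∃ v', (v, v') ∈ G.E ∧ P v') ∧
  (G.owner v ≠ p → ∀ v', (v, v') ∈ G.E → P v')

variable {G}

theorem Cpre.mono {p : Player} {P Q : V → Prop} {v : V} (h : G.Cpre p P v)
    (hPQ : ∀ v', (v, v') ∈ G.E → P v' → Q v') : G.Cpre p Q v :=
  ⟨fun ho => let ⟨v', he, hP⟩ := h.1 ho; ⟨v', he, hPQ v' he hP⟩,
    fun ho v' he => hPQ v' he (h.2 ho v' he)⟩

theorem cpre_two_of_not_cpre_one {P : V → Prop} {v : V} (h : ¬ G.Cpre .one P v) :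
    G.Cpre .two (fun v' => ¬ P v') v := by
  cases ho : G.owner v <;> simp_all [Cpre]

/-- The play `ρ` starts in `v₀` and is consistent with the strategy `σ`. -/
def Follows {p : Player} (σ : G.Strategy p) (v₀ : V) (ρ : ℕ → V) : Prop :=
  ρ 0 = v₀ ∧ ∀ k, (ρ k, ρ (k + 1)) ∈ G.E ∧
    (G.owner (ρ k) = p → ρ (k + 1) = σ.toFun ((List.range k).map ρ) (ρ k))

theorem Follows.isPlay {p : Player} {σ : G.Strategy p} {v₀ : V} {ρ : ℕ → V}
    (h : Follows σ v₀ ρ) : G.IsPlay ρ := fun k => (h.2 k).1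

theorem outHist_fst (v₀ : V) (σ₁ : G.Strategy .one) (σ₂ : G.Strategy .two) (k : ℕ) :
    (G.outHist v₀ σ₁ σ₂ k).1 = (List.range k).map (G.out v₀ σ₁ σ₂) := by
  induction k with
  | zero => rfl
  | succ k ih => rw [List.range_succ, List.map_append, ← ih]; rfl

theorem out_succ (v₀ : V) (σ₁ : G.Strategy .one) (σ₂ : G.Strategy .two) (k : ℕ) :
    G.out v₀ σ₁ σ₂ (k + 1) = match G.owner (G.out v₀ σ₁ σ₂ k) with
      | .one => σ₁.toFun ((List.range k).map (G.out v₀ σ₁ σ₂)) (G.out v₀ σ₁ σ₂ k)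
      | .two => σ₂.toFun ((List.range k).map (G.out v₀ σ₁ σ₂)) (G.out v₀ σ₁ σ₂ k) := by
  rw [← outHist_fst]; rfl

theorem out_mem_E (v₀ : V) (σ₁ : G.Strategy .one) (σ₂ : G.Strategy .two) (k : ℕ) :
    (G.out v₀ σ₁ σ₂ k, G.out v₀ σ₁ σ₂ (k + 1)) ∈ G.E := by
  rw [out_succ]
  cases ho : G.owner (G.out v₀ σ₁ σ₂ k)
  · exact σ₁.valid _ _ ho
  · exact σ₂.valid _ _ ho

theorem follows_out_one (v₀ : V) (σ₁ : G.Strategy .one) (σ₂ : G.Strategy .two) :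
    Follows σ₁ v₀ (G.out v₀ σ₁ σ₂) :=
  ⟨rfl, fun k => ⟨out_mem_E v₀ σ₁ σ₂ k, fun ho => by rw [out_succ, ho]⟩⟩

theorem follows_out_two (v₀ : V) (σ₁ : G.Strategy .one) (σ₂ : G.Strategy .two) :
    Follows σ₂ v₀ (G.out v₀ σ₁ σ₂) :=
  ⟨rfl, fun k => ⟨out_mem_E v₀ σ₁ σ₂ k, fun ho => by rw [out_succ, ho]⟩⟩

theorem disjoint_win₁_win₂ (Ω : Set (ℕ → V)) : Disjoint (G.Win₁ Ω) (G.Win₂ Ω) :=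
  Set.disjoint_left.2 fun _ ⟨σ₁, h₁⟩ ⟨σ₂, h₂⟩ => h₂ σ₁ (h₁ σ₂)

/-- A Moore machine over a finite state type in any universe encodes a strategy with as much memory
as the type has elements. -/
theorem Strategy.hasMemory_of_moore {p : Player} {σ : G.Strategy p} {M : Type*} [Finite M]
    (A : Moore V M)
    (h : ∀ h v, G.owner v = p → σ.toFun h v = A.next (h.foldl A.update A.init) v) :
    σ.HasMemory (Nat.card M) := by
  let e := Finite.equivFin M
  refine ⟨Fin (Nat.card M), inferInstance,
    ⟨e A.init, fun m v => e (A.update (e.symm m) v), fun m v => A.next (e.symm m) v⟩,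
    by simp, fun l v ho => ?_⟩
  have key : ∀ (l : List V) (m : M),
      l.foldl (fun m v => e (A.update (e.symm m) v)) (e m) = e (l.foldl A.update m) := by
    intro l
    induction l with
    | nil => intro m; rfl
    | cons a l ih => intro m; simp [ih]
  simp only [key, Equiv.symm_apply_apply]
  exact h l v ho

theorem Strategy.HasMemory.mono {p : Player} {σ : G.Strategy p} {N N' : ℕ} (h : σ.HasMemory N)
    (hN : N ≤ N') : σ.HasMemory N' :=
  let ⟨M, i, A, hc, hA⟩ := h
  ⟨M, i, A, hc.trans hN, hA⟩

/-- If player `p` can maintain a finite invariant set `S` of configurations, moving along the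
relation `R`, then a strategy whose memory is the last configuration does so. The extra memory
state stands for the empty history. -/
theorem exists_strategy_of_invariant {p : Player} {K : Type*} {S : Set K} (hS : S.Finite)
    (vert : K → V) (R : K → K → Prop)
    (h : ∀ c ∈ S, G.Cpre p (fun v' => ∃ c' ∈ S, vert c' = v' ∧ R c c') (vert c))
    {c₀ : K} (hc₀ : c₀ ∈ S) :
    ∃ σ : G.Strategy p, σ.HasMemory (S.ncard + 1) ∧ ∀ ρ, Follows σ (vert c₀) ρ →
      ∃ c : ℕ → K, c 0 = c₀ ∧ ∀ t, c t ∈ S ∧ vert (c t) = ρ t ∧ R (c t) (c (t + 1)) := by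
  have hnext : ∀ (c : S) (v : V), ∃ u, (v, u) ∈ G.E ∧
      (G.owner v = p → vert c = v → ∃ c' : S, vert c' = u ∧ R c c') := by
    intro c v
    by_cases hv : G.owner v = p ∧ vert c = v
    · obtain ⟨ho, rfl⟩ := hv
      obtain ⟨u, he, c', hc', h1, h2⟩ := (h c c.2).1 ho
      exact ⟨u, he, fun _ _ => ⟨⟨c', hc'⟩, h1, h2⟩⟩
    · obtain ⟨u, hu⟩ := G.no_deadlock v
      exact ⟨u, hu, fun h1 h2 => absurd ⟨h1, h2⟩ hv⟩
  choose nxt hnE hnR using hnext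
  have hstep : ∀ (c : S) (u : V), ∃ c' : S,
      (∃ c'' : S, vert c'' = u ∧ R c c'') → vert c' = u ∧ R c c' := by
    intro c u
    by_cases hc : ∃ c'' : S, vert c'' = u ∧ R c c''
    · obtain ⟨c', hc'⟩ := hc
      exact ⟨c', fun _ => hc'⟩
    · exact ⟨c, fun hh => absurd hh hc⟩
  choose step hstep using hstep
  let cfg : Option S → V → S := fun m v => m.elim ⟨c₀, hc₀⟩ fun c => step c v
  let A : Moore V (Option S) := ⟨none, fun m v => some (cfg m v), fun m v => nxt (cfg m v) v⟩
  have : Finite S := hS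
  let σ : G.Strategy p := ⟨fun h v => A.next (h.foldl A.update A.init) v, fun h v _ => hnE _ _⟩
  refine ⟨σ, ?_, fun ρ hρ => ?_⟩
  · have := Strategy.hasMemory_of_moore (σ := σ) A fun h v _ => rfl
    rwa [Finite.card_option, Nat.card_coe_set_eq] at this
  let m : ℕ → Option S := fun t => ((List.range t).map ρ).foldl A.update A.init
  let c : ℕ → S := fun t => cfg (m t) (ρ t)
  have hc : ∀ t, c (t + 1) = step (c t) (ρ (t + 1)) := by
    intro t
    have : m (t + 1) = some (c t) := by
      simp only [m, List.range_succ, List.map_append, List.foldl_append]; rfl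
    simp only [c, this]; rfl
  have hsucc : ∀ t, vert (c t) = ρ t →
      vert (c (t + 1)) = ρ (t + 1) ∧ R (c t) (c (t + 1)) := by
    intro t ht
    rw [hc t]
    apply hstep
    by_cases ho : G.owner (ρ t) = p
    · rw [(hρ.2 t).2 ho]
      exact hnR (c t) (ρ t) ho ht
    · obtain ⟨c', hc', h1, h2⟩ := (h (c t) (c t).2).2 (ht ▸ ho) _ (ht ▸ (hρ.2 t).1)
      exact ⟨⟨c', hc'⟩, h1, h2⟩
  have hvert : ∀ t, vert (c t) = ρ t := by
    intro t
    induction t with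
    | zero => exact hρ.1.symm
    | succ t ih => exact (hsucc t ih).1
  exact ⟨fun t => c t, rfl, fun t => ⟨(c t).2, hvert t, (hsucc t (hvert t)).2⟩⟩

/-! ### Windows and debts -/

theorem TP_succ (ρ : ℕ → V) (k l : ℕ) :
    G.TP ρ k (l + 1) = G.w (ρ k) (ρ (k + 1)) + G.TP ρ (k + 1) l := by
  rw [TP, TP, Finset.sum_range_succ', add_comm]
  refine congrArg₂ _ rfl (Finset.sum_congr rfl fun i _ => ?_)
  rw [show k + (i + 1) = k + 1 + i by ring]

theorem TP_zero (ρ : ℕ → V) (k : ℕ) : G.TP ρ k 0 = 0 := by simp [TP]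

theorem zero_le_MP {ρ : ℕ → V} {k l : ℕ} (hl : 1 ≤ l) : 0 ≤ G.MP ρ k l ↔ 0 ≤ G.TP ρ k l := by
  have : (0 : ℚ) < l := by exact_mod_cast hl
  rw [MP, le_div_iff₀ this, zero_mul]
  norm_cast

theorem natAbs_w_le_maxWeight [Finite V] {u v : V} (h : (u, v) ∈ G.E) :
    (G.w u v).natAbs ≤ G.maxWeight := by
  refine le_trans ?_ (le_max_right _ _)
  exact le_csSup ((Set.toFinite _).bddAbove) ⟨(u, v), h, rfl⟩

theorem one_le_maxWeight : 1 ≤ G.maxWeight := le_max_left _ _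

variable (G)

/-- Player 1 can force, within `i` steps from `v`, that a window whose current sum is `-d` closes
in `X`, or closes in `Z` after a visit to `U`; here `f` tells whether `U` was visited
before `v`. When the sum becomes nonnegative, player 1 may also go on: the debt is then reset to `0`
by the truncation in `Int.toNat`, which opens a new window, while the flag and the remaining number
of steps are kept. -/
def Force (U X Z : Set V) : ℕ → Prop → V → ℕ → Prop
  | 0, _, _, _ => False
  | i + 1, f, v, d => G.Cpre .one (fun v' =>
      Force U X Z i (f ∨ v ∈ U) v' ((d : ℤ) - G.w v v').toNat ∨
        ((d : ℤ) ≤ G.w v v' ∧ (v' ∈ X ∨ (f ∨ v ∈ U) ∧ v' ∈ Z))) v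

/-- The vertices from which player 1 can force the closing of windows as in `Force` within `lam`
steps. -/
def forceSet (U : Set V) (lam : ℕ) (Z X : Set V) : Set V := {v | G.Force U X Z lam False v 0}

/-- The iterates, from `∅`, towards the least fixed point of `X ↦ forceSet U lam Z X`. -/
def inner (U : Set V) (lam : ℕ) (Z : Set V) : ℕ → Set V
  | 0 => ∅
  | j + 1 => G.forceSet U lam Z (inner U lam Z j)

/-- The iterates, from `V`, towards the greatest fixed point of the map that sends `Z` to the least
fixed point of `X ↦ forceSet U lam Z X`; this least fixed point is reached after
`Nat.card V` rounds. -/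
def outer (U : Set V) (lam : ℕ) : ℕ → Set V
  | 0 => Set.univ
  | k + 1 => G.inner U lam (outer U lam k) (Nat.card V)

variable {G} {U X Z : Set V} {lam : ℕ}

theorem Force.mono {X' Z' : Set V} (hX : X ⊆ X') (hZ : Z ⊆ Z') {i i' : ℕ} {f f' : Prop} {v : V}
    {d d' : ℕ} (h : G.Force U X Z i f v d) (hi : i ≤ i') (hf : f → f') (hd : d' ≤ d) :
    G.Force U X' Z' i' f' v d' := by
  induction i generalizing i' f f' v d d' with
  | zero => exact h.elim
  | succ i ih =>
    obtain ⟨i', rfl⟩ : ∃ j, i' = j + 1 := ⟨i' - 1, by omega⟩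
    refine Cpre.mono h fun v' _ hv' => ?_
    have hff : f ∨ v ∈ U → f' ∨ v ∈ U := Or.imp_left hf
    refine hv'.imp (fun hF => ih hF (by omega) hff (by omega)) fun hT => ⟨by omega, ?_⟩
    exact hT.2.imp (fun h => hX h) fun h => ⟨hff h.1, hZ h.2⟩

/-- If both targets coincide, it is irrelevant whether `U` was visited. -/
theorem Force.forget {i : ℕ} {f f' : Prop} {v : V} {d : ℕ}
    (h : G.Force U Z Z i f v d) : G.Force U Z Z i f' v d := by
  induction i generalizing f f' v d with
  | zero => exact h.elim
  | succ i ih =>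
    refine Cpre.mono h fun v' _ hv' => ?_
    exact hv'.imp (fun hF => ih hF) fun hT => ⟨hT.1, Or.inl (hT.2.elim id And.right)⟩

theorem Force.debt_le [Finite V] {i : ℕ} {f : Prop} {v : V} {d : ℕ} (h : G.Force U X Z i f v d) :
    d ≤ i * G.maxWeight := by
  induction i generalizing f v d with
  | zero => exact h.elim
  | succ i ih =>
    obtain ⟨v', he, hv'⟩ : ∃ v', (v, v') ∈ G.E ∧ _ := by
      by_cases ho : G.owner v = .one
      · exact h.1 ho
      · obtain ⟨v', he⟩ := G.no_deadlock v
        exact ⟨v', he, h.2 ho v' he⟩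
    have hw := natAbs_w_le_maxWeight he
    rw [add_mul, one_mul]
    rcases hv' with hF | hT
    · have := ih hF
      omega
    · omega

theorem forceSet_mono {Z' X' : Set V} (hZ : Z ⊆ Z') (hX : X ⊆ X') :
    G.forceSet U lam Z X ⊆ G.forceSet U lam Z' X' :=
  fun _ h => Force.mono hX hZ h le_rfl id le_rfl

theorem inner_mono {Z' : Set V} (hZ : Z ⊆ Z') (j : ℕ) :
    G.inner U lam Z j ⊆ G.inner U lam Z' j := by
  induction j with
  | zero => exact subset_rfl
  | succ j ih => exact forceSet_mono hZ ih

theorem inner_subset_succ (j : ℕ) : G.inner U lam Z j ⊆ G.inner U lam Z (j + 1) := by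
  induction j with
  | zero => exact Set.empty_subset _
  | succ j ih => exact forceSet_mono subset_rfl ih

/-- An increasing sequence of subsets of `V` that remains constant once two consecutive terms agree
is constant from the index `|V|` on. -/
theorem eq_succ_of_card {V : Type*} [Finite V] (a : ℕ → Set V) (hm : ∀ k, a k ⊆ a (k + 1))
    (hc : ∀ k, a k = a (k + 1) → a (k + 1) = a (k + 2)) : a (Nat.card V) = a (Nat.card V + 1) := by
  have key : ∀ k, a k = a (k + 1) ∨ k + 1 ≤ (a (k + 1)).ncard := by
    intro k
    induction k with
    | zero =>
      rcases eq_or_ne (a 0) (a (0 + 1)) with h | h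
      · exact Or.inl h
      · have := Set.ncard_lt_ncard ((hm 0).ssubset_of_ne h)
        right; omega
    | succ k ih =>
      rcases eq_or_ne (a (k + 1)) (a (k + 2)) with h | h
      · exact Or.inl h
      · have h1 := Set.ncard_lt_ncard ((hm (k + 1)).ssubset_of_ne h)
        rcases ih with h2 | h2
        · exact absurd (hc k h2) h
        · right; omega
  rcases key (Nat.card V) with h | h
  · exact h
  · have := Set.ncard_le_card (a (Nat.card V + 1))
    omega

theorem inner_card_succ [Finite V] :
    G.inner U lam Z (Nat.card V + 1) = G.inner U lam Z (Nat.card V) :=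
  (eq_succ_of_card (G.inner U lam Z) inner_subset_succ fun k h => by
    rw [inner, h]; rfl).symm

theorem inner_subset_card [Finite V] (j : ℕ) :
    G.inner U lam Z j ⊆ G.inner U lam Z (Nat.card V) := by
  induction j with
  | zero => exact Set.empty_subset _
  | succ j ih => rw [← inner_card_succ]; exact forceSet_mono subset_rfl ih

theorem outer_succ_subset (k : ℕ) : G.outer U lam (k + 1) ⊆ G.outer U lam k := by
  induction k with
  | zero => exact Set.subset_univ _
  | succ k ih => exact inner_mono ih _

theorem inner_subset_outer [Finite V] (j k : ℕ) :
    G.inner U lam (G.outer U lam k) j ⊆ G.outer U lam k :=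
  (inner_subset_card j).trans (outer_succ_subset k)

/-- `outer (k + 1)` is a fixed point of `X ↦ forceSet U lam (outer k) X`. -/
theorem forceSet_outer [Finite V] (k : ℕ) :
    G.forceSet U lam (G.outer U lam k) (G.outer U lam (k + 1)) = G.outer U lam (k + 1) :=
  inner_card_succ

variable (G) in
/-- The greatest fixed point, which is the winning set of player 1 for the window mean-payoff
Büchi objective. -/
def winSet (U : Set V) (lam : ℕ) : Set V := G.outer U lam (Nat.card V)

theorem outer_card_succ [Finite V] :
    G.outer U lam (Nat.card V + 1) = G.winSet U lam := by
  have := eq_succ_of_card (fun k => (G.outer U lam k)ᶜ)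
    (fun k => Set.compl_subset_compl.2 (outer_succ_subset k)) fun k h => by
      rw [compl_inj_iff] at h ⊢
      rw [outer, h]; rfl
  exact (compl_injective this).symm

theorem inner_winSet [Finite V] :
    G.inner U lam (G.winSet U lam) (Nat.card V) = G.winSet U lam := outer_card_succ

theorem forceSet_winSet [Finite V] :
    G.forceSet U lam (G.winSet U lam) (G.winSet U lam) = G.winSet U lam := by
  have := inner_card_succ (G := G) (U := U) (lam := lam) (Z := G.winSet U lam)
  rwa [inner, inner_winSet] at this

/-- The coinduction principle for the greatest fixed point. -/
theorem subset_winSet [Finite V] {A : Set V} {N : ℕ} (hA : A ⊆ G.inner U lam A N) :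
    A ⊆ G.winSet U lam := by
  have : ∀ k, A ⊆ G.outer U lam k := by
    intro k
    induction k with
    | zero => exact Set.subset_univ _
    | succ k ih => exact hA.trans ((inner_subset_card N).trans (inner_mono ih _))
  exact this _

/-- All vertices that are visited while player 1 forces windows to close in the winning set lie in
the winning set. -/
theorem Force.mem_winSet [Finite V] {i : ℕ} {f : Prop} {v : V} {d : ℕ} (hi : i ≤ lam)
    (h : G.Force U (G.winSet U lam) (G.winSet U lam) i f v d) : v ∈ G.winSet U lam := by
  rw [← forceSet_winSet]
  exact Force.mono subset_rfl subset_rfl h.forget hi id (Nat.zero_le _)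

end Game

/-! ### The winning strategies -/

namespace Game

variable {V : Type*} {G : Game V} {U : Set V} {lam : ℕ}

variable (G) in
/-- The least `j` such that player 1 can force the closing in the `j`-th inner iterate or, after a
visit to `U`, in the winning set. A configuration consists of the current vertex, the flag, the
debt, and the number of remaining steps. -/
noncomputable def rank (U : Set V) (lam : ℕ) (c : V × Prop × ℕ × ℕ) : ℕ :=
  sInf {j | G.Force U (G.inner U lam (G.winSet U lam) j) (G.winSet U lam) c.2.2.2 c.2.1 c.1 c.2.2.1}

theorem rank_le {j i d : ℕ} {f : Prop} {v : V}
    (h : G.Force U (G.inner U lam (G.winSet U lam) j) (G.winSet U lam) i f v d) :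
    G.rank U lam (v, f, d, i) ≤ j := Nat.sInf_le h

theorem force_rank {j i d : ℕ} {f : Prop} {v : V}
    (h : G.Force U (G.inner U lam (G.winSet U lam) j) (G.winSet U lam) i f v d) :
    G.Force U (G.inner U lam (G.winSet U lam) (G.rank U lam (v, f, d, i)))
      (G.winSet U lam) i f v d :=
  Nat.sInf_mem (s := {j | G.Force U (G.inner U lam (G.winSet U lam) j) (G.winSet U lam) i f v d})
    ⟨j, h⟩

theorem ncard_config_le [Finite V] (lam W : ℕ) (hlam : 1 ≤ lam) (hW : 1 ≤ W) :
    ((Set.univ : Set V) ×ˢ (Set.univ : Set Prop) ×ˢ Set.Iic (lam * W) ×ˢ Set.Iic lam).ncard ≤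
      8 * (lam ^ 2 * W * Nat.card V) := by
  simp only [Set.ncard_prod, Set.ncard_univ, Nat.card_eq_fintype_card (α := Prop),
    Fintype.card_prop, ← Nat.card_coe_set_eq (Set.Iic _), Nat.card_eq_fintype_card (α := Set.Iic _),
    Fintype.card_Iic, Nat.card_Iic]
  have h1 : lam * W + 1 ≤ 2 * (lam * W) := by nlinarith
  have h2 : lam + 1 ≤ 2 * lam := by omega
  calc Nat.card V * (2 * ((lam * W + 1) * (lam + 1)))
      ≤ Nat.card V * (2 * ((2 * (lam * W)) * (2 * lam))) := by gcongr
    _ = _ := by ring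

theorem finite_config [Finite V] (a b : ℕ) :
    ((Set.univ : Set V) ×ˢ (Set.univ : Set Prop) ×ˢ Set.Iic a ×ˢ Set.Iic b).Finite :=
  Set.finite_univ.prod (Set.finite_univ.prod ((Set.finite_Iic a).prod (Set.finite_Iic b)))

/-- Player 1 wins from the greatest fixed point. He plays according to the least rank, so that the
rank need not be stored in the memory; the pair of the rank and the number of remaining steps
decreases lexicographically until a window closes after a visit to `U`. At any time, the debt is
paid off within the remaining steps, whence the window that is opened at this time closes as
well. -/
theorem exists_strategy_one [Finite V] (hlam : 1 ≤ lam) {v : V} (hv : v ∈ G.winSet U lam) :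
    ∃ σ : G.Strategy .one, σ.HasMemory (9 * (lam ^ 2 * G.maxWeight * Nat.card V)) ∧
      ∀ ρ, Follows σ v ρ → ρ ∈ G.WMP lam 0 ∩ G.Buchi U := by
  set Z := G.winSet U lam with hZ
  let S : Set (V × Prop × ℕ × ℕ) := {c | c.2.2.2 ≤ lam ∧
    ∃ j, G.Force U (G.inner U lam Z j) Z c.2.2.2 c.2.1 c.1 c.2.2.1}
  have hsub : S ⊆ Set.univ ×ˢ Set.univ ×ˢ Set.Iic (lam * G.maxWeight) ×ˢ Set.Iic lam := by
    rintro ⟨v, f, d, i⟩ ⟨hi, j, hF⟩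
    exact ⟨trivial, trivial, hF.debt_le.trans (Nat.mul_le_mul_right _ hi), hi⟩
  have hfin : S.Finite := (finite_config _ _).subset hsub
  have hcard : S.ncard + 1 ≤ 9 * (lam ^ 2 * G.maxWeight * Nat.card V) := by
    have h1 := (Set.ncard_le_ncard hsub (finite_config _ _)).trans
      (ncard_config_le lam G.maxWeight hlam one_le_maxWeight)
    have h2 : 0 < lam ^ 2 * G.maxWeight * Nat.card V :=
      Nat.mul_pos (Nat.mul_pos (by positivity) one_le_maxWeight)
        (Nat.card_pos_iff.2 ⟨⟨v⟩, inferInstance⟩)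
    omega
  let R : V × Prop × ℕ × ℕ → V × Prop × ℕ × ℕ → Prop := fun c c' =>
    (c'.2.1 → c.2.1 ∨ c.1 ∈ U) ∧ 1 ≤ c.2.2.2 ∧
    ((c'.2.2.2 + 1 = c.2.2.2 ∧ (c'.2.2.1 : ℤ) = max 0 (c.2.2.1 - G.w c.1 c'.1) ∧
        G.rank U lam c' ≤ G.rank U lam c) ∨
      ((c.2.2.1 : ℤ) ≤ G.w c.1 c'.1 ∧
        (G.rank U lam c' < G.rank U lam c ∨ ((c.2.1 ∨ c.1 ∈ U) ∧ ¬ c'.2.1))))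
  have hinv : ∀ c ∈ S, G.Cpre .one (fun v' => ∃ c' ∈ S, c'.1 = v' ∧ R c c') c.1 := by
    rintro ⟨v, f, d, i⟩ ⟨hi, j, hF⟩
    replace hF := force_rank hF
    set r := G.rank U lam (v, f, d, i) with hr
    cases i with
    | zero => exact hF.elim
    | succ i =>
    refine Cpre.mono hF ?_
    rintro v' - (hA | ⟨hd, hB | hC⟩)
    · exact ⟨(v', f ∨ v ∈ U, ((d : ℤ) - G.w v v').toNat, i), ⟨by simp at hi ⊢; omega, r, hA⟩, rfl,
        id, by simp, Or.inl ⟨rfl, by simp only [Int.toNat_eq_max, max_comm], rank_le hA⟩⟩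
    · obtain ⟨r', hr'⟩ : ∃ r', r = r' + 1 := by
        refine ⟨r - 1, ?_⟩
        rcases Nat.eq_zero_or_pos r with h0 | h0
        · rw [h0] at hB; exact hB.elim
        · omega
      rw [hr'] at hB
      refine ⟨(v', False, 0, lam), ⟨le_rfl, r', hB⟩, rfl, False.elim, by simp,
        Or.inr ⟨hd, Or.inl ?_⟩⟩
      have := rank_le (G := G) (U := U) (lam := lam) hB
      rw [← hr]; omega
    · have h1 : v' ∈ G.inner U lam Z (Nat.card V + 1) := by
        rw [inner_card_succ, inner_winSet]; exact hC.2
      exact ⟨(v', False, 0, lam), ⟨le_rfl, _, h1⟩, rfl, False.elim, by simp,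
        Or.inr ⟨hd, Or.inr ⟨hC.1, id⟩⟩⟩
  have h0 : ((v, False, 0, lam) : V × Prop × ℕ × ℕ) ∈ S := by
    have h1 : v ∈ G.inner U lam Z (Nat.card V + 1) := by
      rw [inner_card_succ, inner_winSet]; exact hv
    exact ⟨le_rfl, _, h1⟩
  obtain ⟨σ, hσ, hc⟩ := exists_strategy_of_invariant hfin Prod.fst R hinv h0
  refine ⟨σ, hσ.mono hcard, fun ρ hρ => ?_⟩
  obtain ⟨c, -, hc⟩ := hc ρ hρ
  have hS : ∀ t, (c t).2.2.2 ≤ lam := fun t => (hc t).1.1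
  have hvert : ∀ t, (c t).1 = ρ t := fun t => (hc t).2.1
  have hR := fun t => (hc t).2.2
  simp only [R, hvert] at hR
  have hwin : ∀ i t, (c t).2.2.2 = i →
      ∃ l, 1 ≤ l ∧ l ≤ i ∧ ((c t).2.2.1 : ℤ) ≤ G.TP ρ t l := by
    intro i
    induction i with
    | zero => intro t ht; have := (hR t).2.1; omega
    | succ i ih =>
      intro t ht
      by_cases hd : ((c t).2.2.1 : ℤ) ≤ G.w (ρ t) (ρ (t + 1))
      · exact ⟨1, le_rfl, by omega, by rw [TP_succ, TP_zero]; omega⟩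
      · obtain ⟨-, -, ⟨h1, h2, -⟩ | ⟨h1, -⟩⟩ := hR t
        · obtain ⟨l, hl1, hl2, hl3⟩ := ih (t + 1) (by omega)
          exact ⟨l + 1, by omega, by omega, by rw [TP_succ]; omega⟩
        · exact absurd h1 hd
  refine ⟨⟨hρ.isPlay, fun t => ?_⟩, hρ.isPlay, fun N => ?_⟩
  · obtain ⟨l, hl1, hl2, hl3⟩ := hwin _ t rfl
    exact ⟨l, hl1, hl2.trans (hS t), (zero_le_MP hl1).2 (by omega)⟩
  · by_contra! hN
    -- a measure decreases at each step that is not a closing after a visit to `U`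
    have hclose : ∀ M, ∃ t, M ≤ t ∧ ((c t).2.1 ∨ ρ t ∈ U) ∧ ¬ (c (t + 1)).2.1 := by
      intro M
      by_contra! hM
      have hdec : ∀ s, G.rank U lam (c (M + s)) * (lam + 1) + (c (M + s)).2.2.2 + s ≤
          G.rank U lam (c M) * (lam + 1) + (c M).2.2.2 := by
        intro s
        induction s with
        | zero => simp
        | succ s ih =>
          rw [← add_assoc M s 1]
          obtain ⟨-, -, ⟨h1, -, h3⟩ | ⟨-, h2 | h2⟩⟩ := hR (M + s)
          · have := Nat.mul_le_mul_right (lam + 1) h3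
            omega
          · have h4 := Nat.mul_le_mul_right (lam + 1) (Nat.succ_le_of_lt h2)
            have := hS (M + s + 1)
            rw [Nat.succ_mul] at h4
            omega
          · exact absurd (hM (M + s) (by omega) h2.1) h2.2
      have := hdec (G.rank U lam (c M) * (lam + 1) + (c M).2.2.2 + 1)
      omega
    obtain ⟨t, ht, -, htf⟩ := hclose N
    have hflag : ∀ s, ¬ (c (t + 1 + s)).2.1 := by
      intro s
      induction s with
      | zero => exact htf
      | succ s ih =>
        intro hf
        exact ((hR (t + 1 + s)).1 hf).elim ih (hN _ (by omega))
    obtain ⟨t', ht', h1, -⟩ := hclose (t + 1)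
    obtain ⟨s, rfl⟩ := Nat.exists_eq_add_of_le ht'
    exact h1.elim (hflag s) (hN _ (by omega))

/-- Player 2 plays from outside `outer (k + 1)` such that no window that closes within `lam` steps
closes in `outer (k + 1)`, or in `outer k` after a visit to `U`. A bound on the number of closings
after a visit to `U` is thus kept in the memory, and each visit to `U` makes it drop, unless some
window is never closed. -/
theorem exists_strategy_two [Finite V] (hlam : 1 ≤ lam) {k : ℕ} (hk : k < Nat.card V) {v : V}
    (hv : v ∉ G.outer U lam (k + 1)) :
    ∃ σ : G.Strategy .two, σ.HasMemory (9 * (lam ^ 2 * G.maxWeight * Nat.card V ^ 2)) ∧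
      ∀ ρ, Follows σ v ρ → ρ ∈ G.WMP lam 0 → ∃ b : ℕ → ℕ, b 0 = k ∧ Antitone b ∧
        ∀ t, ρ t ∈ U → ∃ t', t ≤ t' ∧ b (t' + 1) < b t' := by
  let S : Set (ℕ × V × Prop × ℕ × ℕ) := {c | c.1 < Nat.card V ∧ c.2.2.2.2 ≤ lam ∧
    c.2.2.2.1 + c.2.2.2.2 * G.maxWeight ≤ lam * G.maxWeight ∧
    ¬ G.Force U (G.outer U lam (c.1 + 1)) (G.outer U lam c.1) c.2.2.2.2 c.2.2.1 c.2.1 c.2.2.2.1}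
  have hsub : S ⊆ Set.Iio (Nat.card V) ×ˢ
      Set.univ ×ˢ Set.univ ×ˢ Set.Iic (lam * G.maxWeight) ×ˢ Set.Iic lam := by
    rintro ⟨k, v, f, d, i⟩ ⟨hk, hi, hd, -⟩
    exact ⟨hk, trivial, trivial, (Nat.le_add_right _ _).trans hd, hi⟩
  have hfin' := (Set.finite_Iio (Nat.card V)).prod
    (finite_config (V := V) (lam * G.maxWeight) lam)
  have hfin : S.Finite := hfin'.subset hsub
  have hcard : S.ncard + 1 ≤ 9 * (lam ^ 2 * G.maxWeight * Nat.card V ^ 2) := by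
    have h1 := Set.ncard_le_ncard hsub hfin'
    rw [Set.ncard_prod, ← Nat.card_coe_set_eq (Set.Iio _),
      Nat.card_eq_fintype_card (α := Set.Iio _), Fintype.card_Iio, Nat.card_Iio] at h1
    have h2 := Nat.mul_le_mul_left (Nat.card V)
      (ncard_config_le (V := V) lam G.maxWeight hlam one_le_maxWeight)
    have h3 : 0 < lam ^ 2 * G.maxWeight * Nat.card V ^ 2 :=
      Nat.mul_pos (Nat.mul_pos (by positivity) one_le_maxWeight)
        (pow_pos (Nat.card_pos_iff.2 ⟨⟨v⟩, inferInstance⟩) 2)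
    have h4 : Nat.card V * (8 * (lam ^ 2 * G.maxWeight * Nat.card V)) =
        8 * (lam ^ 2 * G.maxWeight * Nat.card V ^ 2) := by ring
    omega
  let R : ℕ × V × Prop × ℕ × ℕ → ℕ × V × Prop × ℕ × ℕ → Prop := fun c c' =>
    c'.1 ≤ c.1 ∧ (1 ≤ c.2.2.2.2 →
      (G.w c.2.1 c'.2.1 < c.2.2.2.1 ∧ c'.2.2.2.2 + 1 = c.2.2.2.2 ∧
        (c'.2.2.2.1 : ℤ) = c.2.2.2.1 - G.w c.2.1 c'.2.1 ∧ (c.2.2.1 ∨ c.2.1 ∈ U → c'.2.2.1)) ∨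
      ((c.2.2.2.1 : ℤ) ≤ G.w c.2.1 c'.2.1 ∧ c'.2.2.2.2 = lam ∧ c'.2.2.2.1 = 0 ∧
        (c.2.2.1 ∨ c.2.1 ∈ U → c'.1 < c.1)))
  have hinv : ∀ c ∈ S, G.Cpre .two (fun v' => ∃ c' ∈ S, c'.2.1 = v' ∧ R c c') c.2.1 := by
    rintro ⟨k, v, f, d, i⟩ ⟨hk, hi, hd, hF⟩
    cases i with
    | zero =>
      -- a window was not closed in time, and any move will do
      have : G.Cpre .two (fun _ => True) v :=
        ⟨fun _ => let ⟨v', he⟩ := G.no_deadlock v; ⟨v', he, trivial⟩, fun _ _ _ => trivial⟩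
      exact this.mono fun v' _ _ => ⟨(k, v', f, d, 0), ⟨hk, hi, hd, id⟩, rfl, le_rfl, by simp⟩
    | succ i =>
    refine (cpre_two_of_not_cpre_one hF).mono fun v' he hv' => ?_
    simp only [not_or, not_and] at hv'
    obtain ⟨hA, hBC⟩ := hv'
    have hw : (G.w v v').natAbs ≤ G.maxWeight := natAbs_w_le_maxWeight he
    simp only at hi hd
    rw [add_mul, one_mul] at hd
    by_cases hdw : (d : ℤ) ≤ G.w v v'
    · obtain ⟨hB, hC⟩ := hBC hdw
      by_cases hf : f ∨ v ∈ U
      · cases k with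
        | zero => exact absurd trivial (hC hf)
        | succ k =>
          exact ⟨(k, v', False, 0, lam), ⟨by simp at hk ⊢; omega, le_rfl, by simp,
            fun h => hC hf (forceSet_outer (G := G) (U := U) (lam := lam) k ▸ h)⟩, rfl,
            Nat.le_succ k, fun _ => Or.inr ⟨hdw, rfl, rfl, fun _ => Nat.lt_succ_self k⟩⟩
      · exact ⟨(k, v', False, 0, lam), ⟨hk, le_rfl, by simp,
            fun h => hB (forceSet_outer (G := G) (U := U) (lam := lam) k ▸ h)⟩, rfl,
            le_rfl, fun _ => Or.inr ⟨hdw, rfl, rfl, fun h => absurd h hf⟩⟩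
    · exact ⟨(k, v', f ∨ v ∈ U, ((d : ℤ) - G.w v v').toNat, i),
        ⟨hk, by simp only; omega, by simp only; omega, hA⟩, rfl, le_rfl,
        fun _ => Or.inl ⟨not_le.1 hdw, rfl, by simp only; omega, id⟩⟩
  have h0 : ((k, v, False, 0, lam) : ℕ × V × Prop × ℕ × ℕ) ∈ S :=
    ⟨hk, le_rfl, by simp,
      fun h => hv (forceSet_outer (G := G) (U := U) (lam := lam) k ▸ h)⟩
  obtain ⟨σ, hσ, hc⟩ := exists_strategy_of_invariant hfin (fun c => c.2.1) R hinv h0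
  refine ⟨σ, hσ.mono hcard, fun ρ hρ hW => ?_⟩
  obtain ⟨c, hc0, hc⟩ := hc ρ hρ
  have hvert : ∀ t, (c t).2.1 = ρ t := fun t => (hc t).2.1
  have hR := fun t => (hc t).2.2
  simp only [R, hvert] at hR
  have hfresh : ∀ t, ∃ l, 1 ≤ l ∧ l ≤ lam ∧ 0 ≤ G.TP ρ t l := fun t => by
    obtain ⟨l, h1, h2, h3⟩ := hW.2 t
    exact ⟨l, h1, h2, (zero_le_MP h1).1 h3⟩
  -- as the play satisfies the window objective, the debt is paid off in time
  have hlive : ∀ t, ∃ l, 1 ≤ l ∧ l ≤ (c t).2.2.2.2 ∧ ((c t).2.2.2.1 : ℤ) ≤ G.TP ρ t l := by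
    intro t
    induction t with
    | zero => simpa [hc0] using hfresh 0
    | succ t ih =>
      obtain ⟨l, h1, h2, h3⟩ := ih
      obtain ⟨l, rfl⟩ : ∃ l', l = l' + 1 := ⟨l - 1, by omega⟩
      rw [TP_succ] at h3
      rcases (hR t).2 (by omega) with ⟨e1, e2, e3, -⟩ | ⟨e1, e2, e3, -⟩
      · rcases Nat.eq_zero_or_pos l with rfl | hl
        · rw [TP_zero] at h3; omega
        · exact ⟨l, hl, by omega, by omega⟩
      · obtain ⟨l, g1, g2, g3⟩ := hfresh (t + 1)
        exact ⟨l, g1, by omega, by omega⟩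
  have hdrop : ∀ i t, (c t).2.2.2.2 = i → ((c t).2.2.1 ∨ ρ t ∈ U) →
      ∃ t', t ≤ t' ∧ (c (t' + 1)).1 < (c t').1 := by
    intro i
    induction i with
    | zero => intro t ht; obtain ⟨l, h1, h2, -⟩ := hlive t; omega
    | succ i ih =>
      intro t ht hf
      rcases (hR t).2 (by omega) with ⟨e1, e2, e3, e4⟩ | ⟨e1, e2, e3, e4⟩
      · obtain ⟨t', h1, h2⟩ := ih (t + 1) (by omega) (Or.inl (e4 hf))
        exact ⟨t', by omega, h2⟩
      · exact ⟨t, le_rfl, e4 hf⟩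
  exact ⟨fun t => (c t).1, by simp [hc0], antitone_nat_of_succ_le fun t => (hR t).1,
    fun t ht => hdrop _ t rfl (Or.inr ht)⟩

theorem winSet_subset_win₁ [Finite V] (hlam : 1 ≤ lam) :
    G.winSet U lam ⊆ G.Win₁ (G.WMP lam 0 ∩ G.Buchi U) := fun v hv =>
  let ⟨σ, _, hσ⟩ := exists_strategy_one hlam hv
  ⟨σ, fun σ₂ => hσ _ (follows_out_one v σ σ₂)⟩

theorem exists_strategy_two_of_not_mem [Finite V] (hlam : 1 ≤ lam) {v : V}
    (hv : v ∉ G.winSet U lam) :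
    ∃ σ : G.Strategy .two, σ.HasMemory (9 * (lam ^ 2 * G.maxWeight * Nat.card V ^ 2)) ∧
      G.Wins₂ (G.WMP lam 0 ∩ G.Buchi U) v σ := by
  have hn : 0 < Nat.card V := Nat.card_pos_iff.2 ⟨⟨v⟩, inferInstance⟩
  obtain ⟨σ, hm, hσ⟩ := exists_strategy_two (G := G) (U := U) hlam (k := Nat.card V - 1)
    (by omega) (v := v) (by rwa [Nat.sub_add_cancel hn])
  refine ⟨σ, hm, fun σ₁ hout => ?_⟩
  obtain ⟨b, hb0, hb, hdrop⟩ := hσ _ (follows_out_two v σ₁ σ) hout.1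
  have key : ∀ N, ∃ t, b t + N ≤ b 0 := by
    intro N
    induction N with
    | zero => exact ⟨0, le_rfl⟩
    | succ N ih =>
      obtain ⟨t, ht⟩ := ih
      obtain ⟨t₁, h1, hU⟩ := hout.2.2 t
      obtain ⟨t₂, h2, h3⟩ := hdrop t₁ hU
      have := hb (h1.trans h2)
      exact ⟨t₂ + 1, by omega⟩
  obtain ⟨t, ht⟩ := key (b 0 + 1)
  omega

theorem win₁_eq_winSet [Finite V] (hlam : 1 ≤ lam) :
    G.Win₁ (G.WMP lam 0 ∩ G.Buchi U) = G.winSet U lam := by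
  refine Set.Subset.antisymm (fun v hv => ?_) (winSet_subset_win₁ hlam)
  by_contra hn
  obtain ⟨σ, -, hσ⟩ := exists_strategy_two_of_not_mem hlam hn
  exact Set.disjoint_left.1 (disjoint_win₁_win₂ _) hv ⟨σ, hσ⟩

theorem win₂_eq_compl_winSet [Finite V] (hlam : 1 ≤ lam) :
    G.Win₂ (G.WMP lam 0 ∩ G.Buchi U) = (G.winSet U lam)ᶜ := by
  refine Set.Subset.antisymm (fun v hv hn => ?_) fun v hv => ?_
  · exact Set.disjoint_left.1 (disjoint_win₁_win₂ _) (winSet_subset_win₁ hlam hn) hv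
  · obtain ⟨σ, -, hσ⟩ := exists_strategy_two_of_not_mem hlam hv
    exact ⟨σ, hσ⟩

/-- From outside the first outer iterate, player 2 ensures that no window closes after a visit
to `U`. -/
theorem win₁_reach_subset [Finite V] (hlam : 1 ≤ lam) :
    G.Win₁ (G.WMP lam 0 ∩ G.Reach U) ⊆ G.outer U lam 1 := by
  rintro v ⟨σ₁, hσ₁⟩
  by_contra hn
  obtain ⟨σ, -, hσ⟩ := exists_strategy_two (G := G) (U := U) hlam (k := 0)
    (Nat.card_pos_iff.2 ⟨⟨v⟩, inferInstance⟩) hn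
  obtain ⟨hW, -, t, ht⟩ := hσ₁ σ
  obtain ⟨b, hb0, hb, hdrop⟩ := hσ _ (follows_out_two v σ₁ σ) hW
  obtain ⟨t', -, h⟩ := hdrop t ht
  have := hb (Nat.zero_le t')
  omega

theorem winSet_subset_win₁_reach [Finite V] (hlam : 1 ≤ lam) :
    G.winSet U lam ⊆ G.Win₁ (G.WMP lam 0 ∩ G.Reach U) := fun v hv => by
  obtain ⟨σ, hσ⟩ := winSet_subset_win₁ hlam hv
  refine ⟨σ, fun σ₂ => ⟨(hσ σ₂).1, (hσ σ₂).2.1, ?_⟩⟩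
  obtain ⟨t, -, ht⟩ := (hσ σ₂).2.2 0
  exact ⟨t, ht⟩

end Game

/-! ### The iteration of losing sets and attractors -/

namespace Game

variable {V : Type*} {G : Game V} {U : Set V} {lam : ℕ}

/-- As all vertices from which player 1 forces a closing in the winning set are themselves winning,
a subgame that contains the winning set contains all the moves needed. -/
theorem Force.restrict [Finite V] {S : Set V} (hS : G.IsClosed .two S)
    (hsub : G.winSet U lam ⊆ S) {X : Set V} (hX : X ⊆ G.winSet U lam) {i : ℕ} (hi : i ≤ lam)
    {f : Prop} {v : V} {d : ℕ} (h : G.Force U X (G.winSet U lam) i f v d) (hv : v ∈ S) :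
    (G.induce .two S hS).Force (Subtype.val ⁻¹' U) (Subtype.val ⁻¹' X)
      (Subtype.val ⁻¹' G.winSet U lam) i f ⟨v, hv⟩ d := by
  induction i generalizing f v d with
  | zero => exact h.elim
  | succ i ih =>
    have hmem : ∀ {f : Prop} {v : V} {d : ℕ}, G.Force U X (G.winSet U lam) i f v d → v ∈ S :=
      fun h => hsub (Force.mem_winSet (by omega) (Force.mono hX subset_rfl h le_rfl id le_rfl))
    refine ⟨fun ho => ?_, fun ho v' he => ?_⟩
    · obtain ⟨v', he, hv'⟩ := h.1 ho
      have hvS : v' ∈ S := hv'.elim hmem fun h => hsub (h.2.elim (fun h => hX h) And.right)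
      exact ⟨⟨v', hvS⟩, he, hv'.imp (fun hF => ih (by omega) hF hvS) id⟩
    · exact (h.2 ho v' he).imp (fun hF => ih (by omega) hF v'.2) id

/-- Player 2 cannot leave the subgame, hence what player 1 can force in the subgame he can force in
the game. -/
theorem Force.of_induce {S : Set V} (hS : G.IsClosed .two S) {X Z : Set S} {i : ℕ}
    {f : Prop} {v : S} {d : ℕ}
    (h : (G.induce .two S hS).Force (Subtype.val ⁻¹' U) X Z i f v d) :
    G.Force U (Subtype.val '' X) (Subtype.val '' Z) i f v d := by
  induction i generalizing f v d with
  | zero => exact h.elim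
  | succ i ih =>
    refine ⟨fun ho => ?_, fun ho v' he => ?_⟩
    · obtain ⟨v', he, hv'⟩ := h.1 ho
      exact ⟨v', he, hv'.imp ih fun hT => ⟨hT.1, hT.2.imp (fun h => ⟨_, h, rfl⟩)
        fun h => ⟨h.1, _, h.2, rfl⟩⟩⟩
    · have ho' : G.owner v = .two := by
        cases ho'' : G.owner v
        · exact absurd ho'' ho
        · rfl
      have hv' := h.2 ho ⟨v', hS.1 v v.2 ho' v' he⟩ he
      exact hv'.imp ih fun hT => ⟨hT.1, hT.2.imp (fun h => ⟨_, h, rfl⟩)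
        fun h => ⟨h.1, _, h.2, rfl⟩⟩

theorem winSet_subset_winSet_induce [Finite V] {S : Set V} (hS : G.IsClosed .two S)
    (hsub : G.winSet U lam ⊆ S) : (Subtype.val ⁻¹' G.winSet U lam : Set S) ⊆
      (G.induce .two S hS).winSet (Subtype.val ⁻¹' U) lam := by
  refine subset_winSet (N := Nat.card V) ?_
  have key : ∀ j, (Subtype.val ⁻¹' G.inner U lam (G.winSet U lam) j : Set S) ⊆
      (G.induce .two S hS).inner (Subtype.val ⁻¹' U) lam (Subtype.val ⁻¹' G.winSet U lam) j := by
    intro j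
    induction j with
    | zero => exact fun _ h => h
    | succ j ih =>
      intro v hv
      have hX : G.inner U lam (G.winSet U lam) j ⊆ G.winSet U lam :=
        (inner_subset_card j).trans inner_winSet.subset
      exact Force.mono ih subset_rfl (Force.restrict hS hsub hX le_rfl hv v.2) le_rfl id le_rfl
  intro v hv
  refine key _ ?_
  rw [inner_winSet]
  exact hv

theorem subset_winSet_of_outer_one [Finite V] {S : Set V} (hS : G.IsClosed .two S)
    (h : (G.induce .two S hS).outer (Subtype.val ⁻¹' U) lam 1 = Set.univ) :
    S ⊆ G.winSet U lam := by
  refine subset_winSet (N := Nat.card S) ?_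
  have key : ∀ j, Subtype.val '' ((G.induce .two S hS).inner (Subtype.val ⁻¹' U) lam Set.univ j) ⊆
      G.inner U lam S j := by
    intro j
    induction j with
    | zero => simp [inner]
    | succ j ih =>
      rintro _ ⟨v, hv, rfl⟩
      exact Force.mono ih (by simp) (Force.of_induce hS hv) le_rfl id le_rfl
  intro v hv
  refine key _ ⟨⟨v, hv⟩, ?_, rfl⟩
  have : (⟨v, hv⟩ : S) ∈ (G.induce .two S hS).outer (Subtype.val ⁻¹' U) lam 1 := by
    rw [h]; trivial
  exact this

theorem winSet_cpre [Finite V] (hlam : 1 ≤ lam) {v : V} (hv : v ∈ G.winSet U lam) :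
    G.Cpre .one (· ∈ G.winSet U lam) v := by
  rw [← forceSet_winSet] at hv
  obtain ⟨i, rfl⟩ : ∃ i, lam = i + 1 := ⟨lam - 1, by omega⟩
  refine Cpre.mono (show G.Force U _ _ _ _ _ _ from hv) ?_
  rintro v' - (h | h)
  · exact h.mem_winSet (by omega)
  · exact h.2.elim id And.right

/-- The winning set is disjoint from the attractor of any set from which it is disjoint. -/
theorem winSet_subset_compl_attr [Finite V] (hlam : 1 ≤ lam) {A : Set V}
    (hA : G.winSet U lam ⊆ Aᶜ) : G.winSet U lam ⊆ (G.attr .two A)ᶜ := by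
  have key : ∀ k, ∀ v ∈ G.winSet U lam, v ∉ G.attrStage .two A k := by
    intro k
    induction k with
    | zero => exact fun v hv => hA hv
    | succ k ih =>
      rintro v hv ((h | ⟨ho, v', he, hv'⟩) | ⟨ho, h⟩)
      · exact ih v hv h
      · exact ih v' ((winSet_cpre hlam hv).2 (by simp [ho]) v' he) hv'
      · obtain ⟨v', he, hv'⟩ := (winSet_cpre hlam hv).1 ho
        exact ih v' hv' (h v' he)
  intro v hv hv'
  obtain ⟨k, hk⟩ := Set.mem_iUnion.1 hv'
  exact key k v hv hk

theorem winSet_subset_wmpReach [Finite V] (hlam : 1 ≤ lam) {S : Set V} (hS : G.IsClosed .two S)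
    (hsub : G.winSet U lam ⊆ S) : G.winSet U lam ⊆ G.wmpReach U lam S hS := fun v hv =>
  ⟨⟨v, hsub hv⟩, winSet_subset_win₁_reach hlam (winSet_subset_winSet_induce hS hsub hv), rfl⟩

theorem wmpReach_subset (S : Set V) (hS : G.IsClosed .two S) : G.wmpReach U lam S hS ⊆ S := by
  rintro _ ⟨v, -, rfl⟩
  exact v.2

theorem subset_winSet_of_wmpReach_eq [Finite V] (hlam : 1 ≤ lam) {S : Set V}
    (hS : G.IsClosed .two S) (h : G.wmpReach U lam S hS = S) : S ⊆ G.winSet U lam := by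
  refine subset_winSet_of_outer_one hS (Set.eq_univ_of_forall fun v => ?_)
  have hv : (v : V) ∈ G.wmpReach U lam S hS := h.symm ▸ v.2
  obtain ⟨v', hv', hvv⟩ := hv
  rw [← Subtype.ext hvv]
  exact win₁_reach_subset hlam hv'

theorem winSet_subset_compl_removed [Finite V] (hlam : 1 ≤ lam) (k : ℕ) :
    G.winSet U lam ⊆ (G.removed U lam k).1ᶜ := by
  induction k with
  | zero => simp [removed]
  | succ k ih =>
    refine winSet_subset_compl_attr hlam ?_
    rw [compl_compl]
    exact winSet_subset_wmpReach hlam _ ih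

theorem compl_candidate_subset_removed [Finite V] (k : ℕ) :
    (G.candidate U lam k)ᶜ ⊆ (G.removed U lam (k + 1)).1 :=
  fun _ hv => Set.mem_iUnion.2 ⟨0, hv⟩

theorem candidate_eq_winSet_of_stops [Finite V] (hlam : 1 ≤ lam) {k : ℕ}
    (h : G.Stops U lam k) : G.candidate U lam k = G.winSet U lam := by
  have h1 : G.winSet U lam ⊆ G.candidate U lam k :=
    winSet_subset_wmpReach hlam _ (winSet_subset_compl_removed hlam k)
  refine Set.Subset.antisymm ?_ h1
  rcases h with h | h
  · rw [h]
    exact subset_winSet_of_wmpReach_eq hlam _ h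
  · simp [h]

/-- As long as the iteration does not stop, at least one vertex is removed in each round. -/
theorem exists_first_stop [Finite V] (U : Set V) (lam : ℕ) :
    ∃ k ≤ Nat.card V, G.Stops U lam k ∧ ∀ j < k, ¬ G.Stops U lam j := by
  classical
  have key : ∀ k, (∀ j < k, ¬ G.Stops U lam j) → k ≤ (G.removed U lam k).1.ncard := by
    intro k
    induction k with
    | zero => intro _; exact Nat.zero_le _
    | succ k ih =>
      intro h
      have h1 := ih fun j hj => h j (by omega)
      have h2 : (G.removed U lam k).1 ⊂ (G.candidate U lam k)ᶜ := by
        refine Set.ssubset_iff_subset_ne.2 ⟨?_, fun he => h k (by omega) (Or.inl ?_)⟩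
        · rw [Set.subset_compl_comm]
          exact wmpReach_subset _ _
        · rw [he, compl_compl]
      have h3 := Set.ncard_lt_ncard h2
      have h4 := Set.ncard_le_ncard (compl_candidate_subset_removed (G := G) (U := U)
        (lam := lam) k)
      omega
  have hex : ∃ k ≤ Nat.card V, G.Stops U lam k := by
    by_contra! hn
    have h1 := key _ fun j hj => hn j (le_of_lt hj)
    refine hn _ le_rfl (Or.inr ?_)
    have h2 : (G.removed U lam (Nat.card V)).1 = Set.univ := by
      refine Set.eq_of_subset_of_ncard_le (Set.subset_univ _) ?_
      rwa [Set.ncard_univ]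
    have h3 : G.candidate U lam (Nat.card V) ⊆ (G.removed U lam (Nat.card V)).1ᶜ :=
      wmpReach_subset _ _
    exact Set.subset_empty_iff.1 (h3.trans (Set.compl_empty_iff.2 h2).subset)
  have hex' : ∃ k, G.Stops U lam k := hex.imp fun k h => h.2
  obtain ⟨k, hk, hks⟩ := hex
  exact ⟨Nat.find hex', (Nat.find_min' hex' hks).trans hk, Nat.find_spec hex',
    fun j hj => Nat.find_min hex' hj⟩

end Game

/-! ### A program logic for the random access machine -/

namespace Ram

/-- The program `c`, started in `s`, halts at cost at most `T` in a state that satisfies `Q`. -/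
def Runs (c : Prog) (s : State) (T : ℕ) (Q : State → Prop) : Prop :=
  ∃ s' t, Exec c s s' t ∧ t ≤ T ∧ Q s'

theorem Runs.mono {c : Prog} {s : State} {T T' : ℕ} {Q Q' : State → Prop} (h : Runs c s T Q)
    (hT : T ≤ T') (hQ : ∀ s', Q s' → Q' s') : Runs c s T' Q' :=
  let ⟨s', t, he, ht, hs⟩ := h
  ⟨s', t, he, ht.trans hT, hQ s' hs⟩

theorem Runs.seq {c d : Prog} {s : State} {T T' : ℕ} {Q Q' : State → Prop} (h : Runs c s T Q)
    (h' : ∀ s', Q s' → Runs d s' T' Q') : Runs (.seq c d) s (T + T') Q' :=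
  let ⟨s', _, he, ht, hs⟩ := h
  let ⟨s'', _, he', ht', hs'⟩ := h' s' hs
  ⟨s'', _, .seq he he', Nat.add_le_add ht ht', hs'⟩

/-- Programs without loops. -/
def Prog.LoopFree : Prog → Prop
  | .seq c d => c.LoopFree ∧ d.LoopFree
  | .ite _ c d => c.LoopFree ∧ d.LoopFree
  | .loop _ _ => False
  | _ => True

open Classical in
/-- The final state of a program without loops (a junk value on loops). -/
noncomputable def Prog.eval : Prog → State → State
  | .skip, s => s
  | .setI x e, s => { s with ireg := Function.update s.ireg x (e.val s) }
  | .storeI a i e, s =>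
    { s with iarr := Function.update s.iarr a (Function.update (s.iarr a) (i.val s) (e.val s)) }
  | .setZ x e, s => { s with zreg := Function.update s.zreg x (e.val s) }
  | .storeZ a i e, s =>
    { s with zarr := Function.update s.zarr a (Function.update (s.zarr a) (i.val s) (e.val s)) }
  | .seq c d, s => d.eval (c.eval s)
  | .ite b c d, s => if b.holds s then c.eval s else d.eval s
  | .loop _ _, s => s

open Classical in
/-- The cost of a program without loops (a junk value on loops). -/
noncomputable def Prog.time : Prog → State → ℕ
  | .skip, _ => 1
  | .setI _ e, _ => e.cost + 1
  | .storeI _ i e, _ => i.cost + e.cost + 1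
  | .setZ _ e, s => e.cost s + 1
  | .storeZ _ i e, s => i.cost + e.cost s + 1
  | .seq c d, s => c.time s + d.time (c.eval s)
  | .ite b c d, s => b.cost s + (if b.holds s then c.time s else d.time s) + 1
  | .loop _ _, _ => 0

theorem Prog.eval_skip (s : State) : Prog.skip.eval s = s := rfl

theorem Prog.eval_seq (c d : Prog) (s : State) : (Prog.seq c d).eval s = d.eval (c.eval s) := rfl

theorem Prog.eval_setI (x : ℕ) (e : IExp) (s : State) :
    (Prog.setI x e).eval s = { s with ireg := Function.update s.ireg x (e.val s) } := rfl

theorem Prog.eval_setZ (x : ℕ) (e : ZExp) (s : State) :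
    (Prog.setZ x e).eval s = { s with zreg := Function.update s.zreg x (e.val s) } := rfl

theorem Prog.eval_storeI (a : ℕ) (i e : IExp) (s : State) : (Prog.storeI a i e).eval s =
    { s with
      iarr := Function.update s.iarr a (Function.update (s.iarr a) (i.val s) (e.val s)) } := rfl

theorem Prog.eval_storeZ (a : ℕ) (i : IExp) (e : ZExp) (s : State) : (Prog.storeZ a i e).eval s =
    { s with
      zarr := Function.update s.zarr a (Function.update (s.zarr a) (i.val s) (e.val s)) } := rfl

theorem Prog.eval_ite_of_holds {b : Test} {c d : Prog} {s : State}
    (h : b.holds s = True) : (Prog.ite b c d).eval s = c.eval s := if_pos (of_eq_true h)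

theorem Prog.eval_ite_of_not_holds {b : Test} {c d : Prog} {s : State} (h : ¬ b.holds s) :
    (Prog.ite b c d).eval s = d.eval s := if_neg h

theorem Prog.time_seq (c d : Prog) (s : State) :
    (Prog.seq c d).time s = c.time s + d.time (c.eval s) := rfl

theorem Prog.time_ite_le {b : Test} {c d : Prog} {s : State} {T : ℕ} (hc : c.time s ≤ T)
    (hd : d.time s ≤ T) : (Prog.ite b c d).time s ≤ b.cost s + T + 1 := by
  simp only [Prog.time]
  split_ifs <;> omega

theorem Prog.LoopFree.exec {c : Prog} (hc : c.LoopFree) (s : State) :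
    Exec c s (c.eval s) (c.time s) := by
  induction c generalizing s with
  | skip => exact .skip s
  | setI x e => exact .setI s x e
  | storeI a i e => exact .storeI s a i e
  | setZ x e => exact .setZ s x e
  | storeZ a i e => exact .storeZ s a i e
  | seq c d ihc ihd => exact .seq (ihc hc.1 s) (ihd hc.2 _)
  | ite b c d ihc ihd =>
    simp only [Prog.eval, Prog.time]
    split_ifs with hb
    · exact .iteTrue hb (ihc hc.1 s)
    · exact .iteFalse hb (ihd hc.2 s)
  | loop b c _ => exact hc.elim

theorem Prog.LoopFree.runs {c : Prog} (hc : c.LoopFree) {s : State} {T : ℕ} {Q : State → Prop}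
    (hT : c.time s ≤ T) (hQ : Q (c.eval s)) : Runs c s T Q :=
  ⟨_, _, hc.exec s, hT, hQ⟩

/-- The loop `for x = 0, …, y - 1 do c`, where `y` is an index register. -/
def Prog.forI (x y : ℕ) (c : Prog) : Prog :=
  .seq (.setI x (.const 0))
    (.loop (.ilt (.reg x) (.reg y)) (.seq c (.setI x (.succ (.reg x)))))

theorem Runs.forI {x y : ℕ} {c : Prog} {n T : ℕ} {Inv : ℕ → State → Prop} (s : State)
    (hxy : x ≠ y) (hy : s.ireg y = n)
    (h0 : Inv 0 { s with ireg := Function.update s.ireg x 0 })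
    (hstep : ∀ k s, k < n → s.ireg x = k → s.ireg y = n → Inv k s → Runs c s T fun s' =>
      s'.ireg x = k ∧ s'.ireg y = n ∧
        Inv (k + 1) { s' with ireg := Function.update s'.ireg x (k + 1) }) :
    Runs (.forI x y c) s (n * (T + 7) + 6) (Inv n) := by
  have key : ∀ r k s, k + r = n → s.ireg x = k → s.ireg y = n → Inv k s →
      Runs (.loop (.ilt (.reg x) (.reg y)) (.seq c (.setI x (.succ (.reg x))))) s
        (r * (T + 7) + 4) (Inv n) := by
    intro r
    induction r with
    | zero =>
      intro k s hk hx hy hI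
      obtain rfl : k = n := by omega
      refine ⟨s, _, .loopDone (by simp [Test.holds, IExp.val, hx, hy]), ?_, hI⟩
      simp [Test.cost, IExp.cost]
    | succ r ih =>
      intro k s hk hx hy hI
      obtain ⟨s', t, he, ht, hx', hy', hI'⟩ := hstep k s (by omega) hx hy hI
      obtain ⟨s'', t', he', ht', hI''⟩ := ih (k + 1)
        { s' with ireg := Function.update s'.ireg x (k + 1) } (by omega) (by simp)
        (by simpa [Function.update_of_ne hxy.symm] using hy') hI'
      have hset := Exec.setI s' x (.succ (.reg x))
      simp only [IExp.val, hx'] at hset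
      refine ⟨s'', _, .loopStep (by simp [Test.holds, IExp.val, hx, hy]; omega)
        (.seq he hset) he', ?_, hI''⟩
      simp only [Test.cost, IExp.cost]
      rw [add_mul, one_mul]
      omega
  obtain ⟨s', t, he, ht, hI⟩ := key n 0 { s with ireg := Function.update s.ireg x 0 } (by simp)
    (by simp) (by simpa [Function.update_of_ne hxy.symm] using hy) h0
  exact ⟨s', _, .seq (.setI s x (.const 0)) he, by simp only [IExp.cost]; omega, hI⟩

/-- The loop `for x = y, …, 1 do c`, where `x` and `y` are number registers. -/
def Prog.downZ (x y : ℕ) (c : Prog) : Prog :=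
  .seq (.setZ x (.reg y))
    (.loop (.neg (.zle (.reg x) (.const 0)))
      (.seq c (.setZ x (.plus (.reg x) (.const (-1))))))

theorem Runs.downZ {x y : ℕ} {c : Prog} {n T B : ℕ} {Inv : ℕ → State → Prop} (s : State)
    (hy : s.zreg y = n) (hB : ∀ k : ℕ, k ≤ n → bitCost k ≤ B) (hB2 : 2 ≤ B)
    (h0 : Inv 0 { s with zreg := Function.update s.zreg x (n : ℤ) })
    (hstep : ∀ k s, k < n → s.zreg x = ((n - k : ℕ) : ℤ) → Inv k s → Runs c s T fun s' =>
      s'.zreg x = ((n - k : ℕ) : ℤ) ∧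
        Inv (k + 1) { s' with zreg := Function.update s'.zreg x ((n - (k + 1) : ℕ) : ℤ) }) :
    Runs (.downZ x y c) s (n * (T + 5 * B + 5) + 3 * B + 5) (Inv n) := by
  have key : ∀ (r k : ℕ) (s : State), k + r = n → s.zreg x = (r : ℤ) → Inv k s →
      Runs (.loop (.neg (.zle (.reg x) (.const 0)))
        (.seq c (.setZ x (.plus (.reg x) (.const (-1)))))) s
        (r * (T + 5 * B + 5) + 2 * B + 4) (Inv n) := by
    have hb0 : bitCost 0 = 1 := by simp [bitCost]
    have hb1 : bitCost (-1) = 2 := by simp [bitCost]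
    intro r
    induction r with
    | zero =>
      intro k s hk hx hI
      obtain rfl : k = n := by omega
      refine ⟨s, _, .loopDone (by simp [Test.holds, ZExp.val, hx]), ?_, hI⟩
      simp [Test.cost, ZExp.cost, hx, hb0]
      omega
    | succ r ih =>
      intro k s hk hx hI
      obtain ⟨s', t, he, ht, hx', hI'⟩ :=
        hstep k s (by omega) (by rw [hx]; congr 1; omega) hI
      have hr : (((n - k : ℕ) : ℤ) + -1) = (r : ℤ) := by omega
      have hr' : n - (k + 1) = r := by omega
      rw [hr'] at hI'
      obtain ⟨s'', t', he', ht', hI''⟩ := ih (k + 1)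
        { s' with zreg := Function.update s'.zreg x (r : ℤ) } (by omega) (by simp) hI'
      have hset := Exec.setZ s' x (.plus (.reg x) (.const (-1)))
      simp only [ZExp.val, ZExp.cost, hx', hr] at hset
      refine ⟨s'', _, .loopStep (by simp [Test.holds, ZExp.val, hx])
        (.seq he hset) he', ?_, hI''⟩
      have h1 := hB (r + 1) (by omega)
      have h2 := hB r (by omega)
      have h3 := hB (n - k) (by omega)
      simp only [Test.cost, ZExp.cost, hx, hb0, hb1]
      rw [add_mul, one_mul]
      omega
  obtain ⟨s', t, he, ht, hI⟩ := key n 0 { s with zreg := Function.update s.zreg x (n : ℤ) }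
    (by simp)
    (by simp) h0
  have hset := Exec.setZ s x (.reg y)
  simp only [ZExp.val, ZExp.cost, hy] at hset
  have := hB n le_rfl
  exact ⟨s', _, .seq hset he, by omega, hI⟩

/-- The states `s` and `s'` agree on the first `I` index registers, `A` index arrays, `R` number
registers and `Z` number arrays. -/
def Keep (I A R Z : ℕ) (s s' : State) : Prop :=
  (∀ x < I, s'.ireg x = s.ireg x) ∧ (∀ a < A, s'.iarr a = s.iarr a) ∧
  (∀ x < R, s'.zreg x = s.zreg x) ∧ (∀ a < Z, s'.zarr a = s.zarr a)

theorem Keep.trans {I A R Z : ℕ} {s s' s'' : State} (h : Keep I A R Z s s')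
    (h' : Keep I A R Z s' s'') : Keep I A R Z s s'' :=
  ⟨fun x hx => (h'.1 x hx).trans (h.1 x hx), fun x hx => (h'.2.1 x hx).trans (h.2.1 x hx),
    fun x hx => (h'.2.2.1 x hx).trans (h.2.2.1 x hx),
    fun x hx => (h'.2.2.2 x hx).trans (h.2.2.2 x hx)⟩

theorem Keep.weaken {I A R Z I' A' R' Z' : ℕ} {s s' : State} (h : Keep I' A' R' Z' s s')
    (hI : I ≤ I' := by omega) (hA : A ≤ A' := by omega) (hR : R ≤ R' := by omega)
    (hZ : Z ≤ Z' := by omega) : Keep I A R Z s s' :=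
  ⟨fun x hx => h.1 x (by omega), fun x hx => h.2.1 x (by omega),
    fun x hx => h.2.2.1 x (by omega), fun x hx => h.2.2.2 x (by omega)⟩

theorem keep_update_ireg {I A R Z : ℕ} (s : State) {x v : ℕ} (hx : I ≤ x) :
    Keep I A R Z s { s with ireg := Function.update s.ireg x v } :=
  ⟨fun y hy => Function.update_of_ne (by omega) _ _, fun _ _ => rfl, fun _ _ => rfl,
    fun _ _ => rfl⟩

theorem keep_update_zreg {I A R Z : ℕ} (s : State) {x : ℕ} {v : ℤ} (hx : R ≤ x) :
    Keep I A R Z s { s with zreg := Function.update s.zreg x v } :=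
  ⟨fun _ _ => rfl, fun _ _ => rfl, fun y hy => Function.update_of_ne (by omega) _ _,
    fun _ _ => rfl⟩

theorem keep_update_zarr {I A R Z : ℕ} (s : State) {x : ℕ} {v : ℕ → ℤ} (hx : Z ≤ x) :
    Keep I A R Z s { s with zarr := Function.update s.zarr x v } :=
  ⟨fun _ _ => rfl, fun _ _ => rfl, fun _ _ => rfl,
    fun y hy => Function.update_of_ne (by omega) _ _⟩

end Ram

/-! ### One step of the dynamic programming -/

namespace Ram

open Function

/-- The value contributed by an edge of weight `w` to a vertex with value `g`, where `t = 1` if this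
vertex belongs to the target. Negative values stand for `-∞`. -/
def edgeValue (g : ℤ) (t : ℕ) (w : ℤ) : ℤ :=
  if g ≤ -1 then (if t = 1 then w else g) else g + w

/-- Compute in the number register `x` the value of the edge whose number is in the index
register 4 and whose target is in the index register 6, for the number array `g` of the values of
the vertices and the index array `a` of the target. -/
def valueProg (g a x : ℕ) : Prog :=
  .seq (.setZ x (.arr g (.reg 6)))
    (.ite (.zle (.reg x) (.const (-1)))
      (.ite (.ieq (.arr a (.reg 6)) (.const 1)) (.setZ x (.arr 0 (.reg 4))) .skip)
      (.setZ x (.plus (.reg x) (.arr 0 (.reg 4)))))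

theorem loopFree_valueProg (g a x : ℕ) : (valueProg g a x).LoopFree := by
  simp [valueProg, Prog.LoopFree]

theorem eval_valueProg (g a x : ℕ) (s : State) :
    (valueProg g a x).eval s = { s with
      zreg := update s.zreg x
        (edgeValue (s.zarr g (s.ireg 6)) (s.iarr a (s.ireg 6)) (s.zarr 0 (s.ireg 4))) } := by
  by_cases h1 : s.zarr g (s.ireg 6) ≤ -1
  · by_cases h2 : s.iarr a (s.ireg 6) = 1 <;>
    simp [valueProg, Prog.eval_seq, Prog.eval_setZ, Prog.eval_skip, Prog.eval_ite_of_holds,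
      Prog.eval_ite_of_not_holds, Test.holds, ZExp.val, IExp.val, edgeValue, h1, h2]
  · simp [valueProg, Prog.eval_seq, Prog.eval_setZ, Prog.eval_ite_of_not_holds, Test.holds,
      ZExp.val, IExp.val, edgeValue, h1]

theorem bitCost_neg_one : bitCost (-1) = 2 := by simp [bitCost]

theorem time_valueProg {g a x B : ℕ} {s : State} (hB : 2 ≤ B)
    (h1 : bitCost (s.zarr g (s.ireg 6)) ≤ B) (h2 : bitCost (s.zarr 0 (s.ireg 4)) ≤ B)
    (h3 : bitCost (s.zarr g (s.ireg 6) + s.zarr 0 (s.ireg 4)) ≤ B) :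
    (valueProg g a x).time s ≤ 12 * B := by
  rw [valueProg, Prog.time_seq]
  have hT := Prog.time_ite_le (T := 6 * B)
    (b := .zle (.reg x) (.const (-1)))
    (c := .ite (.ieq (.arr a (.reg 6)) (.const 1)) (.setZ x (.arr 0 (.reg 4))) .skip)
    (d := .setZ x (.plus (.reg x) (.arr 0 (.reg 4))))
    (s := (Prog.setZ x (.arr g (.reg 6))).eval s)
    ((Prog.time_ite_le (T := B + 2) ?_ ?_).trans ?_) ?_
  · refine (Nat.add_le_add_left hT _).trans ?_
    simp only [Prog.time, Prog.eval_setZ, ZExp.cost, Test.cost, ZExp.val, IExp.val, IExp.cost,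
      update_self, bitCost_neg_one]
    omega
  all_goals
    simp only [Prog.time, Prog.eval_setZ, ZExp.cost, Test.cost, ZExp.val, IExp.val, IExp.cost,
      update_self]
    omega

/-- The value of the edge `e` if `U` was visited before its target is reached. -/
def val₁ (s : State) (e : ℕ) : ℤ :=
  edgeValue (s.zarr 2 (s.iarr 3 e)) (s.iarr 4 (s.iarr 3 e)) (s.zarr 0 e)

/-- The value of the edge `e` if `U` was not visited before its source is reached. -/
def val₀ (s : State) (e : ℕ) : ℤ :=
  if s.iarr 1 (s.iarr 2 e) = 1 then val₁ s e else
    edgeValue (s.zarr 1 (s.iarr 3 e)) (s.iarr 5 (s.iarr 3 e)) (s.zarr 0 e)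

theorem val₁_congr {s s' : State} (h : Keep 4 6 2 3 s s') : val₁ s' = val₁ s := by
  obtain ⟨-, h2, -, h4⟩ := h
  funext e
  simp only [val₁, h2 3 (by omega), h2 4 (by omega), h4 0 (by omega), h4 2 (by omega)]

theorem val₀_congr {s s' : State} (h : Keep 4 6 2 3 s s') : val₀ s' = val₀ s := by
  have h1 := val₁_congr h
  obtain ⟨-, h2, -, h4⟩ := h
  funext e
  simp only [val₀, h1, h2 1 (by omega), h2 2 (by omega), h2 3 (by omega), h2 5 (by omega),
    h4 0 (by omega), h4 1 (by omega)]

/-- For the edge whose number is in the index register 4, load the source and the target into the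
index registers 5 and 6, and its two values into the number registers 2 and 3. -/
def edgeProg : Prog :=
  .seq (.setI 5 (.arr 2 (.reg 4))) (.seq (.setI 6 (.arr 3 (.reg 4))) (.seq (valueProg 2 4 3)
    (.ite (.ieq (.arr 1 (.reg 5)) (.const 1)) (.setZ 2 (.reg 3)) (valueProg 1 5 2))))

/-- The state after `edgeProg` for the edge `e`. -/
def edgeState (s : State) (e : ℕ) : State :=
  { s with
    ireg := update (update s.ireg 5 (s.iarr 2 e)) 6 (s.iarr 3 e)
    zreg := update (update s.zreg 3 (val₁ s e)) 2 (val₀ s e) }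

theorem eval_edgeProg {s : State} {e : ℕ} (he : s.ireg 4 = e) :
    edgeProg.eval s = edgeState s e := by
  subst he
  by_cases h : s.iarr 1 (s.iarr 2 (s.ireg 4)) = 1 <;>
  simp [edgeProg, Prog.eval_seq, Prog.eval_setI, Prog.eval_setZ, Prog.eval_ite_of_holds,
    Prog.eval_ite_of_not_holds, eval_valueProg, Test.holds, ZExp.val, IExp.val, edgeState,
    val₀, val₁, h]

/-- All the numbers that occur when the values are computed have bit cost at most `B`. -/
structure Small (s : State) (m N B : ℕ) : Prop where
  weight : ∀ e < m, (s.zarr 0 e).natAbs ≤ N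
  value₀ : ∀ e < m, (s.zarr 1 (s.iarr 3 e)).natAbs ≤ N
  value₁ : ∀ e < m, (s.zarr 2 (s.iarr 3 e)).natAbs ≤ N
  two_le : 2 ≤ B
  bits : ∀ z : ℤ, z.natAbs ≤ 2 * N → bitCost z ≤ B

theorem Small.congr {s s' : State} {m N B : ℕ} (h : Small s m N B) (hk : Keep 4 6 2 3 s s') :
    Small s' m N B := by
  obtain ⟨-, h2, -, h4⟩ := hk
  refine ⟨?_, ?_, ?_, h.two_le, h.bits⟩
  · simpa only [h4 0 (by omega)] using h.weight
  · simpa only [h4 1 (by omega), h2 3 (by omega)] using h.value₀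
  · simpa only [h4 2 (by omega), h2 3 (by omega)] using h.value₁

theorem natAbs_edgeValue_le {g w : ℤ} {t N : ℕ} (hg : g.natAbs ≤ N) (hw : w.natAbs ≤ N) :
    (edgeValue g t w).natAbs ≤ 2 * N := by
  rw [edgeValue]
  split_ifs <;> omega

theorem Small.natAbs_val₁ {s : State} {m N B e : ℕ} (h : Small s m N B) (he : e < m) :
    (val₁ s e).natAbs ≤ 2 * N := natAbs_edgeValue_le (h.value₁ e he) (h.weight e he)

theorem Small.natAbs_val₀ {s : State} {m N B e : ℕ} (h : Small s m N B) (he : e < m) :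
    (val₀ s e).natAbs ≤ 2 * N := by
  rw [val₀]
  split_ifs
  · exact h.natAbs_val₁ he
  · exact natAbs_edgeValue_le (h.value₀ e he) (h.weight e he)

theorem loopFree_edgeProg : edgeProg.LoopFree := by
  simp [edgeProg, Prog.LoopFree, loopFree_valueProg]

theorem time_edgeProg {s : State} {m N B e : ℕ} (h : Small s m N B) (hm : e < m)
    (he : s.ireg 4 = e) : edgeProg.time s ≤ 32 * B := by
  have h2 := h.two_le
  have g0 := h.weight e hm
  have g1 := h.value₀ e hm
  have g2 := h.value₁ e hm
  have g3 := h.bits _ (h.natAbs_val₁ hm)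
  have t1 : (valueProg 2 4 3).time
      { s with ireg := update (update s.ireg 5 (s.iarr 2 e)) 6 (s.iarr 3 e) } ≤ 12 * B := by
    apply time_valueProg h2 <;> simp [he] <;> apply h.bits <;> omega
  have t2 : (valueProg 1 5 2).time
      { s with
        ireg := update (update s.ireg 5 (s.iarr 2 e)) 6 (s.iarr 3 e)
        zreg := update s.zreg 3 (val₁ s e) } ≤ 12 * B := by
    apply time_valueProg h2 <;> simp [he] <;> apply h.bits <;> omega
  have e1 : ((valueProg 2 4 3).eval
      { s with ireg := update (update s.ireg 5 (s.iarr 2 e)) 6 (s.iarr 3 e) }) =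
      { s with
        ireg := update (update s.ireg 5 (s.iarr 2 e)) 6 (s.iarr 3 e)
        zreg := update s.zreg 3 (val₁ s e) } := by
    simp [eval_valueProg, val₁, he]
  have e0 : (Prog.setI 6 (.arr 3 (.reg 4))).eval ((Prog.setI 5 (.arr 2 (.reg 4))).eval s) =
      { s with ireg := update (update s.ireg 5 (s.iarr 2 e)) 6 (s.iarr 3 e) } := by
    simp [Prog.eval_setI, IExp.val, he]
  simp only [edgeProg, Prog.time_seq, e0, e1]
  refine (Nat.add_le_add_left (Nat.add_le_add_left (Nat.add_le_add_left
    (Prog.time_ite_le (T := 12 * B) ?_ t2) _) _) _).trans ?_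
  · simp only [Prog.time, ZExp.cost, update_self]
    omega
  · simp only [Prog.time, IExp.cost, Test.cost]
    omega

/-- Each source of an edge `e < k` has in the array `a` the value of one of its edges. -/
def Attain (src : ℕ → ℕ) (val : ℕ → ℤ) (a : ℕ → ℤ) (k : ℕ) : Prop :=
  ∀ e < k, ∃ e' < k, src e' = src e ∧ a (src e) = val e'

/-- For the edges `e < k`, the array `a` bounds the values, from above for sources of player 1 and
from below for sources of player 2. -/
def Bound (own src : ℕ → ℕ) (val : ℕ → ℤ) (a : ℕ → ℤ) (k : ℕ) : Prop :=
  ∀ e < k, if own (src e) = 1 then val e ≤ a (src e) else a (src e) ≤ val e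

/-- The better one of two values for the owner of a vertex. -/
def better (o : ℕ) (x y : ℤ) : ℤ := if o = 1 then max x y else min x y

variable {own src : ℕ → ℕ} {val a : ℕ → ℤ} {k m : ℕ}

theorem Attain.succ (h : Attain src val a k) :
    Attain src val (update a (src k) (val k)) (k + 1) := by
  intro e he
  by_cases hs : src e = src k
  · exact ⟨k, by omega, hs.symm, by simp [hs]⟩
  · have : e < k := by
      rcases Nat.lt_succ_iff_lt_or_eq.1 he with h | rfl
      · exact h
      · exact absurd rfl hs
    obtain ⟨e', h1, h2, h3⟩ := h e this
    exact ⟨e', by omega, h2, by simpa [hs] using h3⟩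

theorem Attain.better (h : Attain src val a m) (hk : k < m) (o : ℕ) :
    Attain src val (update a (src k) (better o (a (src k)) (val k))) m := by
  intro e he
  by_cases hs : src e = src k
  · have : Ram.better o (a (src k)) (val k) = a (src k) ∨
        Ram.better o (a (src k)) (val k) = val k := by
      rw [Ram.better]
      split_ifs
      · exact max_choice _ _
      · exact min_choice _ _
    rcases this with h1 | h1
    · obtain ⟨e', h2, h3, h4⟩ := h e he
      exact ⟨e', h2, h3, by rw [hs, update_self, h1, ← h4, hs]⟩
    · exact ⟨k, hk, hs.symm, by rw [hs, update_self, h1]⟩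
  · obtain ⟨e', h1, h2, h3⟩ := h e he
    exact ⟨e', h1, h2, by simpa [hs] using h3⟩

theorem Bound.succ (h : Bound own src val a k) :
    Bound own src val (update a (src k) (better (own (src k)) (a (src k)) (val k))) (k + 1) := by
  intro e he
  by_cases hs : src e = src k
  · rcases Nat.lt_succ_iff_lt_or_eq.1 he with hlt | rfl
    · have := h e hlt
      simp only [hs, update_self, better] at this ⊢
      split_ifs at this ⊢
      · exact this.trans (le_max_left _ _)
      · exact (min_le_left _ _).trans this
    · simp only [update_self, better]
      split_ifs
      · exact le_max_right _ _
      · exact min_le_right _ _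
  · have hlt : e < k := by
      rcases Nat.lt_succ_iff_lt_or_eq.1 he with h | rfl
      · exact h
      · exact absurd rfl hs
    simpa [hs] using h e hlt

/-- Initialize the new values with the value of some edge. -/
def initBody : Prog :=
  .seq edgeProg (.seq (.storeZ 3 (.reg 5) (.reg 2)) (.storeZ 4 (.reg 5) (.reg 3)))

/-- Replace the new value of the source of the current edge, in the array `a`, by the value of the
edge, in the register `x`, if this is better for the owner. -/
def improveProg (a x : ℕ) : Prog :=
  .ite (.ieq (.arr 0 (.reg 5)) (.const 1))
    (.ite (.zle (.reg x) (.arr a (.reg 5))) .skip (.storeZ a (.reg 5) (.reg x)))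
    (.ite (.zle (.arr a (.reg 5)) (.reg x)) .skip (.storeZ a (.reg 5) (.reg x)))

/-- Improve the new values by those of the current edge. -/
def improveBody : Prog := .seq edgeProg (.seq (improveProg 3 2) (improveProg 4 3))

theorem keep_edgeState (s : State) (e : ℕ) : Keep 4 6 2 3 s (edgeState s e) :=
  (keep_update_ireg s (x := 5) (v := s.iarr 2 e) (by omega)).trans
    ((keep_update_ireg _ (x := 6) (v := s.iarr 3 e) (by omega)).trans
      ((keep_update_zreg _ (x := 3) (v := val₁ s e) (by omega)).trans
        (keep_update_zreg _ (x := 2) (v := val₀ s e) (by omega))))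

theorem eval_initBody {s : State} {e : ℕ} (he : s.ireg 4 = e) :
    initBody.eval s = { edgeState s e with
      zarr := update (update s.zarr 3 (update (s.zarr 3) (s.iarr 2 e) (val₀ s e))) 4
        (update (s.zarr 4) (s.iarr 2 e) (val₁ s e)) } := by
  simp [initBody, Prog.eval_seq, Prog.eval_storeZ, eval_edgeProg he, edgeState, IExp.val, ZExp.val]

theorem eval_improveProg (a x : ℕ) (s : State) :
    (improveProg a x).eval s = { s with zarr := update s.zarr a (update (s.zarr a) (s.ireg 5)
      (better (s.iarr 0 (s.ireg 5)) (s.zarr a (s.ireg 5)) (s.zreg x))) } := by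
  by_cases h1 : s.iarr 0 (s.ireg 5) = 1
  · by_cases h2 : s.zreg x ≤ s.zarr a (s.ireg 5)
    · simp [improveProg, Prog.eval_skip, Prog.eval_ite_of_holds, Test.holds, IExp.val, ZExp.val,
        better, h1, h2]
    · simp [improveProg, Prog.eval_storeZ, Prog.eval_ite_of_holds, Prog.eval_ite_of_not_holds,
        Test.holds, IExp.val, ZExp.val, better, h1, h2, le_of_not_ge h2]
  · by_cases h2 : s.zarr a (s.ireg 5) ≤ s.zreg x
    · simp [improveProg, Prog.eval_skip, Prog.eval_ite_of_holds, Prog.eval_ite_of_not_holds,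
        Test.holds, IExp.val, ZExp.val, better, h1, h2]
    · simp [improveProg, Prog.eval_storeZ, Prog.eval_ite_of_not_holds,
        Test.holds, IExp.val, ZExp.val, better, h1, h2, le_of_not_ge h2]

theorem eval_improveBody {s : State} {e : ℕ} (he : s.ireg 4 = e) :
    improveBody.eval s = { edgeState s e with
      zarr := update (update s.zarr 3 (update (s.zarr 3) (s.iarr 2 e)
          (better (s.iarr 0 (s.iarr 2 e)) (s.zarr 3 (s.iarr 2 e)) (val₀ s e)))) 4
        (update (s.zarr 4) (s.iarr 2 e)
          (better (s.iarr 0 (s.iarr 2 e)) (s.zarr 4 (s.iarr 2 e)) (val₁ s e))) } := by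
  simp [improveBody, Prog.eval_seq, eval_edgeProg he, eval_improveProg, edgeState]

theorem loopFree_initBody : initBody.LoopFree := by
  simp [initBody, Prog.LoopFree, loopFree_edgeProg]

theorem loopFree_improveBody : improveBody.LoopFree := by
  simp [improveBody, improveProg, Prog.LoopFree, loopFree_edgeProg]

theorem time_initBody {s : State} {m N B e : ℕ} (h : Small s m N B) (hm : e < m)
    (he : s.ireg 4 = e) : initBody.time s ≤ 40 * B := by
  have h1 := time_edgeProg h hm he
  have h2 := h.two_le
  have g1 := h.bits _ (h.natAbs_val₁ hm)
  have g0 := h.bits _ (h.natAbs_val₀ hm)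
  simp only [initBody, Prog.time, eval_edgeProg he, Prog.eval_storeZ, ZExp.cost, IExp.cost,
    edgeState,
    update_self, update_of_ne (show (3 : ℕ) ≠ 2 by omega)]
  omega

theorem time_improveProg {a x B : ℕ} {s : State} (hB : 2 ≤ B) (h1 : bitCost (s.zreg x) ≤ B)
    (h2 : bitCost (s.zarr a (s.ireg 5)) ≤ B) : (improveProg a x).time s ≤ 10 * B := by
  refine (Prog.time_ite_le (T := 6 * B) ((Prog.time_ite_le (T := 2 * B) ?_ ?_).trans ?_)
    ((Prog.time_ite_le (T := 2 * B) ?_ ?_).trans ?_)).trans ?_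
  all_goals
    simp only [Prog.time, Test.cost, IExp.cost, ZExp.cost, IExp.val]
    omega

theorem time_improveBody {s : State} {m N B e : ℕ} (h : Small s m N B) (hm : e < m)
    (he : s.ireg 4 = e) (h3 : bitCost (s.zarr 3 (s.iarr 2 e)) ≤ B)
    (h4 : bitCost (s.zarr 4 (s.iarr 2 e)) ≤ B) : improveBody.time s ≤ 52 * B := by
  have h1 := time_edgeProg h hm he
  have h2 := h.two_le
  have t1 : (improveProg 3 2).time (edgeState s e) ≤ 10 * B :=
    time_improveProg h2 (by simpa [edgeState] using h.bits _ (h.natAbs_val₀ hm))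
      (by simpa [edgeState] using h3)
  have t2 : (improveProg 4 3).time ((improveProg 3 2).eval (edgeState s e)) ≤ 10 * B := by
    apply time_improveProg h2
    · simpa [edgeState, eval_improveProg] using h.bits _ (h.natAbs_val₁ hm)
    · simpa [edgeState, eval_improveProg] using h4
  simp only [improveBody, Prog.time_seq, eval_edgeProg he]
  omega

theorem runs_init {s : State} {m N B : ℕ} (h : Small s m N B) (hm : s.ireg 1 = m) :
    Runs (.forI 4 1 initBody) s (m * (40 * B + 7) + 6) fun s' => Keep 4 6 2 3 s s' ∧
      Attain (s.iarr 2) (val₀ s) (s'.zarr 3) m ∧ Attain (s.iarr 2) (val₁ s) (s'.zarr 4) m := by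
  refine Runs.forI (Inv := fun k s' => Keep 4 6 2 3 s s' ∧
      Attain (s.iarr 2) (val₀ s) (s'.zarr 3) k ∧ Attain (s.iarr 2) (val₁ s) (s'.zarr 4) k)
    s (by omega) hm ⟨keep_update_ireg s le_rfl, fun e he => absurd he (by omega),
      fun e he => absurd he (by omega)⟩ fun k s' hk h4 h1 ⟨hK, hA₀, hA₁⟩ => ?_
  refine loopFree_initBody.runs (time_initBody (h.congr hK) hk h4) ?_
  rw [eval_initBody h4]
  have hs : s'.iarr 2 = s.iarr 2 := hK.2.1 2 (by omega)
  refine ⟨by simp [edgeState, h4], by simp [edgeState, h1], ?_, ?_, ?_⟩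
  · refine (hK.trans (keep_edgeState s' k)).trans ?_
    exact ((keep_update_zarr _ (x := 3) (by omega)).trans
      (keep_update_zarr _ (x := 4) (by omega))).trans (keep_update_ireg _ (x := 4) (by omega))
  · simpa [hs, val₀_congr hK] using hA₀.succ
  · simpa [hs, val₁_congr hK] using hA₁.succ

theorem Attain.natAbs_le {src : ℕ → ℕ} {N : ℕ} (h : Attain src val a m) (hk : k < m)
    (hv : ∀ e < m, (val e).natAbs ≤ N) : (a (src k)).natAbs ≤ N := by
  obtain ⟨e, he, -, h2⟩ := h k hk
  rw [h2]
  exact hv e he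

theorem runs_improve {s : State} {m N B : ℕ} (h : Small s m N B) (hm : s.ireg 1 = m)
    (hA₀ : Attain (s.iarr 2) (val₀ s) (s.zarr 3) m)
    (hA₁ : Attain (s.iarr 2) (val₁ s) (s.zarr 4) m) :
    Runs (.forI 4 1 improveBody) s (m * (52 * B + 7) + 6) fun s' => Keep 4 6 2 3 s s' ∧
      (Attain (s.iarr 2) (val₀ s) (s'.zarr 3) m ∧ Attain (s.iarr 2) (val₁ s) (s'.zarr 4) m) ∧
      Bound (s.iarr 0) (s.iarr 2) (val₀ s) (s'.zarr 3) m ∧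
      Bound (s.iarr 0) (s.iarr 2) (val₁ s) (s'.zarr 4) m := by
  refine Runs.forI (Inv := fun k s' => Keep 4 6 2 3 s s' ∧
      (Attain (s.iarr 2) (val₀ s) (s'.zarr 3) m ∧ Attain (s.iarr 2) (val₁ s) (s'.zarr 4) m) ∧
      Bound (s.iarr 0) (s.iarr 2) (val₀ s) (s'.zarr 3) k ∧
      Bound (s.iarr 0) (s.iarr 2) (val₁ s) (s'.zarr 4) k)
    s (by omega) hm ⟨keep_update_ireg s le_rfl, ⟨hA₀, hA₁⟩, fun e he => absurd he (by omega),
      fun e he => absurd he (by omega)⟩ fun k s' hk h4 h1 ⟨hK, ⟨hA₀, hA₁⟩, hB₀, hB₁⟩ => ?_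
  have hs : s'.iarr 2 = s.iarr 2 := hK.2.1 2 (by omega)
  have ho : s'.iarr 0 = s.iarr 0 := hK.2.1 0 (by omega)
  refine loopFree_improveBody.runs (time_improveBody (h.congr hK) hk h4
    (hs ▸ h.bits _ (hA₀.natAbs_le hk fun e he => h.natAbs_val₀ he))
    (hs ▸ h.bits _ (hA₁.natAbs_le hk fun e he => h.natAbs_val₁ he))) ?_
  rw [eval_improveBody h4]
  refine ⟨by simp [edgeState, h4], by simp [edgeState, h1], ?_, ⟨?_, ?_⟩, ?_, ?_⟩
  · refine (hK.trans (keep_edgeState s' k)).trans ?_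
    exact ((keep_update_zarr _ (x := 3) (by omega)).trans
      (keep_update_zarr _ (x := 4) (by omega))).trans (keep_update_ireg _ (x := 4) (by omega))
  · simpa [hs, ho, val₀_congr hK] using hA₀.better hk _
  · simpa [hs, ho, val₁_congr hK] using hA₁.better hk _
  · simpa [hs, ho, val₀_congr hK] using hB₀.succ
  · simpa [hs, ho, val₁_congr hK] using hB₁.succ

/-- Copy the new value of the current vertex. -/
def copyBody : Prog :=
  .seq (.storeZ 1 (.reg 4) (.arr 3 (.reg 4))) (.storeZ 2 (.reg 4) (.arr 4 (.reg 4)))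

theorem eval_copyBody {s : State} {i : ℕ} (hi : s.ireg 4 = i) :
    copyBody.eval s = { s with
      zarr := update (update s.zarr 1 (update (s.zarr 1) i (s.zarr 3 i))) 2
        (update (s.zarr 2) i (s.zarr 4 i)) } := by
  simp [copyBody, Prog.eval_seq, Prog.eval_storeZ, IExp.val, ZExp.val, hi]

theorem runs_copy {s : State} {n B : ℕ} (hn : s.ireg 0 = n) (hB2 : 2 ≤ B)
    (hB₀ : ∀ i < n, bitCost (s.zarr 3 i) ≤ B) (hB₁ : ∀ i < n, bitCost (s.zarr 4 i) ≤ B) :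
    Runs (.forI 4 0 copyBody) s (n * (6 * B + 7) + 6) fun s' => Keep 4 6 2 1 s s' ∧
      ∀ i < n, s'.zarr 1 i = s.zarr 3 i ∧ s'.zarr 2 i = s.zarr 4 i := by
  refine (Runs.forI (Inv := fun k s' => Keep 4 6 2 1 s s' ∧ (s'.zarr 3 = s.zarr 3 ∧
      s'.zarr 4 = s.zarr 4) ∧ ∀ i < k, s'.zarr 1 i = s.zarr 3 i ∧ s'.zarr 2 i = s.zarr 4 i)
    s (by omega) hn ⟨keep_update_ireg s le_rfl, ⟨rfl, rfl⟩, fun e he => absurd he (by omega)⟩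
    fun k s' hk h4 h1 ⟨hK, ⟨h3, h4'⟩, hI⟩ => ?_).mono le_rfl fun s' h => ⟨h.1, h.2.2⟩
  refine Prog.LoopFree.runs (by simp [copyBody, Prog.LoopFree]) ?_ ?_
  · have g0 := hB₀ k hk
    have g1 := hB₁ k hk
    simp [copyBody, Prog.time, IExp.cost, ZExp.cost, Prog.eval_storeZ, IExp.val, h4, h3, h4']
    omega
  rw [eval_copyBody h4]
  refine ⟨by simp [h4], by simp [h1], ?_, by simp [h3, h4'], fun i hi => ?_⟩
  · exact (hK.trans ((keep_update_zarr _ (x := 1) (by omega)).trans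
      (keep_update_zarr _ (x := 2) (by omega)))).trans (keep_update_ireg _ (x := 4) (by omega))
  · by_cases hik : i = k
    · simp [hik, h3, h4']
    · simpa [hik] using hI i (by omega)

end Ram

/-! ### Correctness of the program -/

namespace Ram

open Function

/-- One step of the dynamic programming for all vertices. -/
def levelProg : Prog :=
  .seq (.forI 4 1 initBody) (.seq (.forI 4 1 improveBody) (.forI 4 0 copyBody))

theorem runs_level {s : State} {n m N B : ℕ} (h : Small s m N B) (hn0 : 1 ≤ n) (hn : s.ireg 0 = n)
    (hm : s.ireg 1 = m) (hsrc : ∀ e < m, s.iarr 2 e < n)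
    (hsurj : ∀ i < n, ∃ e < m, s.iarr 2 e = i) :
    Runs levelProg s ((n + m) * (108 * B)) fun s' => Keep 4 6 2 1 s s' ∧
      (Attain (s.iarr 2) (val₀ s) (s'.zarr 1) m ∧ Attain (s.iarr 2) (val₁ s) (s'.zarr 2) m) ∧
      Bound (s.iarr 0) (s.iarr 2) (val₀ s) (s'.zarr 1) m ∧
      Bound (s.iarr 0) (s.iarr 2) (val₁ s) (s'.zarr 2) m := by
  have hB := h.two_le
  refine ((runs_init h hm).seq fun s₁ ⟨hK₁, hA₀, hA₁⟩ => ?_).mono (T := (m * (40 * B + 7) + 6) +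
    ((m * (52 * B + 7) + 6) + (n * (6 * B + 7) + 6))) ?_ fun _ h => h
  · have hs2 : s₁.iarr 2 = s.iarr 2 := hK₁.2.1 2 (by omega)
    have hs0 : s₁.iarr 0 = s.iarr 0 := hK₁.2.1 0 (by omega)
    have hI := runs_improve (h.congr hK₁) ((hK₁.1 1 (by omega)).trans hm)
      (by rwa [hs2, val₀_congr hK₁]) (by rwa [hs2, val₁_congr hK₁])
    rw [hs2, hs0, val₀_congr hK₁, val₁_congr hK₁] at hI
    refine hI.seq fun s₂ ⟨hK₂, ⟨hA₀, hA₁⟩, hB₀, hB₁⟩ => ?_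
    have hK := hK₁.trans hK₂
    refine (runs_copy (B := B) ((hK.1 0 (by omega)).trans hn) hB ?_ ?_).mono le_rfl ?_
    · intro i hi
      obtain ⟨e, he, rfl⟩ := hsurj i hi
      exact h.bits _ (hA₀.natAbs_le he fun e he => h.natAbs_val₀ he)
    · intro i hi
      obtain ⟨e, he, rfl⟩ := hsurj i hi
      exact h.bits _ (hA₁.natAbs_le he fun e he => h.natAbs_val₁ he)
    · rintro s₃ ⟨hK₃, hcopy⟩
      have e1 : ∀ e < m, s₃.zarr 1 (s.iarr 2 e) = s₂.zarr 3 (s.iarr 2 e) :=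
        fun e he => (hcopy _ (hsrc e he)).1
      have e2 : ∀ e < m, s₃.zarr 2 (s.iarr 2 e) = s₂.zarr 4 (s.iarr 2 e) :=
        fun e he => (hcopy _ (hsrc e he)).2
      refine ⟨hK.weaken.trans hK₃, ⟨fun e he => ?_, fun e he => ?_⟩, fun e he => ?_, fun e he => ?_⟩
      · rw [e1 e he]; exact hA₀ e he
      · rw [e2 e he]; exact hA₁ e he
      · rw [e1 e he]; exact hB₀ e he
      · rw [e2 e he]; exact hB₁ e he
  · have : 18 ≤ (n + m) * 18 := by omega
    have h1 : (n + m) * 16 * 2 ≤ (n + m) * 16 * B := Nat.mul_le_mul_left _ hB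
    nlinarith

/-- The integer `z` is the largest element of the downward closed set `P` of natural numbers, and
negative if `P` is empty. -/
def Codes (P : ℕ → Prop) (z : ℤ) : Prop := ∀ d : ℕ, P d ↔ (d : ℤ) ≤ z

theorem codes_edgeValue {P : ℕ → Prop} {g w : ℤ} {t : ℕ} {T : Prop} (hg : Codes P g)
    (ht : t = 1 ↔ T) :
    Codes (fun d => P ((d : ℤ) - w).toNat ∨ ((d : ℤ) ≤ w ∧ T)) (edgeValue g t w) := by
  intro d
  simp only [hg _, edgeValue, ← ht]
  split_ifs <;> omega

theorem neg_le_edgeValue {g w : ℤ} {t W : ℕ} (hg : -(W : ℤ) ≤ g) (hw : w.natAbs ≤ W) :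
    -(W : ℤ) ≤ edgeValue g t w := by
  rw [edgeValue]
  split_ifs <;> omega

theorem codes_cpre {V : Type*} {G : Game V} {v : V} {P : V → ℕ → Prop} {z : ℤ}
    (val : ∀ v', (v, v') ∈ G.E → ℤ) (hval : ∀ v' he, Codes (P v') (val v' he))
    (hz : ∃ v' he, z = val v' he) (h1 : G.owner v = .one → ∀ v' he, val v' he ≤ z)
    (h2 : G.owner v ≠ .one → ∀ v' he, z ≤ val v' he) :
    Codes (fun d => G.Cpre .one (fun v' => P v' d) v) z := by
  obtain ⟨u, hu, rfl⟩ := hz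
  refine fun d => ⟨fun h => ?_, fun h => ⟨fun _ => ⟨u, hu, (hval u hu d).2 h⟩, fun ho v' he =>
    (hval v' he d).2 (h.trans (h2 ho v' he))⟩⟩
  by_cases ho : G.owner v = .one
  · obtain ⟨v', he, hP⟩ := h.1 ho
    exact ((hval v' he d).1 hP).trans (h1 ho v' he)
  · exact (hval u hu d).1 (h.2 ho u hu)

/-- The array `a` holds the indicator function of `X`. -/
def Indicates {V : Type*} (ev : Fin (Nat.card V) ≃ V) (s : State) (a : ℕ) (X : Set V) : Prop :=
  ∀ v, (v ∈ X → s.iarr a (ev.symm v) = 1) ∧ (v ∉ X → s.iarr a (ev.symm v) = 0)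

theorem Indicates.eq_one_iff {V : Type*} {ev : Fin (Nat.card V) ≃ V} {s : State} {a : ℕ}
    {X : Set V} (h : Indicates ev s a X) (v : V) : s.iarr a (ev.symm v) = 1 ↔ v ∈ X := by
  by_cases hv : v ∈ X
  · simp [hv, (h v).1 hv]
  · simp [hv, (h v).2 hv]

theorem Indicates.congr {V : Type*} {ev : Fin (Nat.card V) ≃ V} {s s' : State} {a : ℕ}
    {X : Set V} (h : Indicates ev s a X) (ha : s'.iarr a = s.iarr a) : Indicates ev s' a X := by
  rw [Indicates, ha]; exact h

variable {V : Type*} {G : Game V} {U : Set V} {lam : ℕ}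
  {ev : Fin (Nat.card V) ≃ V} {ee : Fin G.E.ncard ≃ G.E} {s : State}

theorem src_input (hs : Keep 2 4 1 1 (input G U lam ev ee) s) {e : ℕ} (he : e < G.E.ncard) :
    s.iarr 2 e = ev.symm (ee ⟨e, he⟩).1.1 := by
  rw [hs.2.1 2 (by omega)]
  simp [input, he]

theorem tgt_input (hs : Keep 2 4 1 1 (input G U lam ev ee) s) {e : ℕ} (he : e < G.E.ncard) :
    s.iarr 3 e = ev.symm (ee ⟨e, he⟩).1.2 := by
  rw [hs.2.1 3 (by omega)]
  simp [input, he]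

theorem weight_input (hs : Keep 2 4 1 1 (input G U lam ev ee) s) {e : ℕ} (he : e < G.E.ncard) :
    s.zarr 0 e = G.w (ee ⟨e, he⟩).1.1 (ee ⟨e, he⟩).1.2 := by
  rw [hs.2.2.2 0 (by omega)]
  simp [input, he]

theorem owner_input (hs : Keep 2 4 1 1 (input G U lam ev ee) s) (v : V) :
    s.iarr 0 (ev.symm v) = 1 ↔ G.owner v = .one := by
  rw [hs.2.1 0 (by omega)]
  cases h : G.owner v <;> simp [input, h]

theorem target_input (hs : Keep 2 4 1 1 (input G U lam ev ee) s) (v : V) :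
    s.iarr 1 (ev.symm v) = 1 ↔ v ∈ U := by
  rw [hs.2.1 1 (by omega)]
  simp [input]

/-- The number arrays 1 and 2 hold, for each vertex, the greatest debt that player 1 can pay off
within `i` steps if `U` was not, or was, visited before. -/
structure Values (G : Game V) (U : Set V) (ev : Fin (Nat.card V) ≃ V) (X Z : Set V) (i : ℕ)
    (s : State) : Prop where
  codes₀ : ∀ v, Codes (G.Force U X Z i False v) (s.zarr 1 (ev.symm v))
  codes₁ : ∀ v, Codes (G.Force U X Z i True v) (s.zarr 2 (ev.symm v))
  neg_le₀ : ∀ v, -(G.maxWeight : ℤ) ≤ s.zarr 1 (ev.symm v)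
  neg_le₁ : ∀ v, -(G.maxWeight : ℤ) ≤ s.zarr 2 (ev.symm v)

theorem Codes.natAbs_le [Finite V] {X Z : Set V} {i : ℕ} {f : Prop} {v : V} {z : ℤ}
    (h : Codes (G.Force U X Z i f v) z) (hz : -(G.maxWeight : ℤ) ≤ z) (hlam : 1 ≤ lam)
    (hi : i ≤ lam) : z.natAbs ≤ lam * G.maxWeight := by
  have h1 : 1 * G.maxWeight ≤ lam * G.maxWeight := Nat.mul_le_mul_right _ hlam
  rcases le_or_gt 0 z with h0 | h0
  · have := ((h z.toNat).2 (by omega)).debt_le.trans (Nat.mul_le_mul_right _ hi)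
    omega
  · omega

theorem Values.small [Finite V] {X Z : Set V} {i B : ℕ} (h : Values G U ev X Z i s)
    (hs : Keep 2 4 1 1 (input G U lam ev ee) s) (hlam : 1 ≤ lam) (hi : i ≤ lam) (hB : 2 ≤ B)
    (hbits : ∀ z : ℤ, z.natAbs ≤ 2 * (lam * G.maxWeight) → bitCost z ≤ B) :
    Small s G.E.ncard (lam * G.maxWeight) B where
  weight e he := by
    rw [weight_input hs he]
    have h1 : 1 * G.maxWeight ≤ lam * G.maxWeight := Nat.mul_le_mul_right _ hlam
    exact (Game.natAbs_w_le_maxWeight (ee ⟨e, he⟩).2).trans (by omega)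
  value₀ e he := by
    rw [tgt_input hs he]
    exact (h.codes₀ _).natAbs_le (h.neg_le₀ _) hlam hi
  value₁ e he := by
    rw [tgt_input hs he]
    exact (h.codes₁ _).natAbs_le (h.neg_le₁ _) hlam hi
  two_le := hB
  bits := hbits

theorem codes_val₁ {X Z : Set V} {i : ℕ} (h : Values G U ev X Z i s)
    (hs : Keep 2 4 1 1 (input G U lam ev ee) s) (hZ : Indicates ev s 4 Z) (hXZ : X ⊆ Z)
    {e : ℕ} (he : e < G.E.ncard) {u v : V} (huv : (ee ⟨e, he⟩).1 = (u, v)) {f : Prop}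
    (hf : f ∨ u ∈ U) :
    Codes (fun d => G.Force U X Z i (f ∨ u ∈ U) v ((d : ℤ) - G.w u v).toNat ∨
      ((d : ℤ) ≤ G.w u v ∧ (v ∈ X ∨ (f ∨ u ∈ U) ∧ v ∈ Z))) (val₁ s e) := by
  have h1 : (v ∈ X ∨ (f ∨ u ∈ U) ∧ v ∈ Z) ↔ v ∈ Z :=
    ⟨fun h => h.elim (fun h => hXZ h) And.right, fun h => Or.inr ⟨hf, h⟩⟩
  have h2 : (f ∨ u ∈ U) = True := eq_true hf
  have := codes_edgeValue (w := G.w u v) (h.codes₁ v) (hZ.eq_one_iff v)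
  rw [val₁, tgt_input hs he, weight_input hs he, huv]
  -- the flag also occurs in the condition simplified by `h1`, which therefore comes first
  simp only [h1]
  simpa only [h2] using this

theorem codes_val₀ {X Z : Set V} {i : ℕ} (h : Values G U ev X Z i s)
    (hs : Keep 2 4 1 1 (input G U lam ev ee) s) (hX : Indicates ev s 5 X)
    (hZ : Indicates ev s 4 Z) (hXZ : X ⊆ Z)
    {e : ℕ} (he : e < G.E.ncard) {u v : V} (huv : (ee ⟨e, he⟩).1 = (u, v)) :
    Codes (fun d => G.Force U X Z i (False ∨ u ∈ U) v ((d : ℤ) - G.w u v).toNat ∨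
      ((d : ℤ) ≤ G.w u v ∧ (v ∈ X ∨ (False ∨ u ∈ U) ∧ v ∈ Z))) (val₀ s e) := by
  have hc : s.iarr 1 (s.iarr 2 e) = 1 ↔ u ∈ U := by rw [src_input hs he, huv, target_input hs]
  rw [val₀]
  by_cases hu : u ∈ U
  · rw [if_pos (hc.2 hu)]
    exact codes_val₁ h hs hZ hXZ he huv (Or.inr hu)
  · have h1 : (v ∈ X ∨ (False ∨ u ∈ U) ∧ v ∈ Z) ↔ v ∈ X := by simp [hu]
    have h2 : (False ∨ u ∈ U) = False := by simp [hu]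
    have := codes_edgeValue (w := G.w u v) (h.codes₀ v) (hX.eq_one_iff v)
    rw [if_neg (mt hc.1 hu), tgt_input hs he, weight_input hs he, huv]
    simp only [h1]
    simpa only [h2] using this

theorem neg_le_val₁ [Finite V] {X Z : Set V} {i : ℕ} (h : Values G U ev X Z i s)
    (hs : Keep 2 4 1 1 (input G U lam ev ee) s) {e : ℕ} (he : e < G.E.ncard) :
    -(G.maxWeight : ℤ) ≤ val₁ s e := by
  rw [val₁, tgt_input hs he, weight_input hs he]
  exact neg_le_edgeValue (h.neg_le₁ _) (Game.natAbs_w_le_maxWeight (ee ⟨e, he⟩).2)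

theorem neg_le_val₀ [Finite V] {X Z : Set V} {i : ℕ} (h : Values G U ev X Z i s)
    (hs : Keep 2 4 1 1 (input G U lam ev ee) s) {e : ℕ} (he : e < G.E.ncard) :
    -(G.maxWeight : ℤ) ≤ val₀ s e := by
  rw [val₀]
  split_ifs
  · exact neg_le_val₁ h hs he
  · rw [tgt_input hs he, weight_input hs he]
    exact neg_le_edgeValue (h.neg_le₀ _) (Game.natAbs_w_le_maxWeight (ee ⟨e, he⟩).2)

/-- An attained bound of the values of the edges codes the controllable predecessor. -/
theorem codes_of_attain_bound (hs : Keep 2 4 1 1 (input G U lam ev ee) s) {val a : ℕ → ℤ}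
    {P : V → V → ℕ → Prop}
    (hval : ∀ e (he : e < G.E.ncard) u v, (ee ⟨e, he⟩).1 = (u, v) → Codes (P u v) (val e))
    (hA : Attain (s.iarr 2) val a G.E.ncard) (hB : Bound (s.iarr 0) (s.iarr 2) val a G.E.ncard)
    (v : V) : Codes (fun d => G.Cpre .one (fun v' => P v v' d) v) (a (ev.symm v)) ∧
      ∃ e < G.E.ncard, a (ev.symm v) = val e := by
  obtain ⟨v₀, hv₀⟩ := G.no_deadlock v
  have hnum : ∀ v' (he : (v, v') ∈ G.E), s.iarr 2 (ee.symm ⟨(v, v'), he⟩) = ev.symm v :=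
    fun v' he => by rw [src_input hs (ee.symm ⟨(v, v'), he⟩).2]; simp
  have hbd : ∀ v' (he : (v, v') ∈ G.E),
      (G.owner v = .one → val (ee.symm ⟨(v, v'), he⟩) ≤ a (ev.symm v)) ∧
      (G.owner v ≠ .one → a (ev.symm v) ≤ val (ee.symm ⟨(v, v'), he⟩)) := by
    intro v' he
    have := hB _ (ee.symm ⟨(v, v'), he⟩).2
    rw [hnum] at this
    constructor
    · intro ho
      rwa [if_pos ((owner_input hs v).2 ho)] at this
    · intro ho
      rwa [if_neg (mt (owner_input hs v).1 ho)] at this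
  obtain ⟨e, he, h1, h2⟩ := hA _ (ee.symm ⟨(v, v₀), hv₀⟩).2
  rw [hnum] at h1 h2
  have hev : (ee ⟨e, he⟩).1.1 = v := by
    rw [src_input hs he] at h1
    exact ev.symm.injective (Fin.ext h1)
  refine ⟨codes_cpre (fun v' he => val (ee.symm ⟨(v, v'), he⟩))
    (fun v' he => hval _ (ee.symm ⟨(v, v'), he⟩).2 v v' (by simp)) ?_
    (fun ho v' he => (hbd v' he).1 ho) (fun ho v' he => (hbd v' he).2 ho), e, he, h2⟩
  have hmem : (v, (ee ⟨e, he⟩).1.2) ∈ G.E := by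
    have := (ee ⟨e, he⟩).2
    rw [← hev]; exact this
  refine ⟨(ee ⟨e, he⟩).1.2, hmem, ?_⟩
  have : (⟨(v, (ee ⟨e, he⟩).1.2), hmem⟩ : G.E) = ee ⟨e, he⟩ := by
    apply Subtype.ext
    simp only [← hev]
  rw [this]
  simpa using h2

/-- The loops over the edges turn the values for `i` steps into those for `i + 1` steps. -/
theorem runs_level_values [Finite V] {X Z : Set V} {i B : ℕ} (h : Values G U ev X Z i s)
    (hs : Keep 2 4 1 1 (input G U lam ev ee) s) (hX : Indicates ev s 5 X)
    (hZ : Indicates ev s 4 Z) (hXZ : X ⊆ Z) (hlam : 1 ≤ lam) (hi : i ≤ lam) (hB : 2 ≤ B)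
    (hbits : ∀ z : ℤ, z.natAbs ≤ 2 * (lam * G.maxWeight) → bitCost z ≤ B) [Nonempty V] :
    Runs levelProg s ((Nat.card V + G.E.ncard) * (108 * B)) fun s' =>
      Keep 4 6 2 1 s s' ∧ Values G U ev X Z (i + 1) s' := by
  refine (runs_level (h.small hs hlam hi hB hbits) (Nat.card_pos (α := V))
    (hs.1 0 (by omega)) (hs.1 1 (by omega)) ?_ ?_).mono le_rfl ?_
  · intro e he
    rw [src_input hs he]
    exact Fin.is_lt _
  · intro k hk
    obtain ⟨v', hv'⟩ := G.no_deadlock (ev ⟨k, hk⟩)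
    refine ⟨ee.symm ⟨_, hv'⟩, Fin.is_lt _, ?_⟩
    rw [src_input hs (Fin.is_lt _)]
    simp
  · rintro s' ⟨hK, ⟨hA₀, hA₁⟩, hB₀, hB₁⟩
    have c₀ := codes_of_attain_bound hs
      (fun e he u v huv => codes_val₀ h hs hX hZ hXZ he huv) hA₀ hB₀
    have c₁ := codes_of_attain_bound hs
      (fun e he u v huv => codes_val₁ h hs hZ hXZ he huv (Or.inl trivial)) hA₁ hB₁
    refine ⟨hK, fun v => (c₀ v).1, fun v => (c₁ v).1, fun v => ?_, fun v => ?_⟩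
    · obtain ⟨e, he, h1⟩ := (c₀ v).2
      rw [h1]; exact neg_le_val₀ h hs he
    · obtain ⟨e, he, h1⟩ := (c₁ v).2
      rw [h1]; exact neg_le_val₁ h hs he

/-- Set all values to `-1`, which codes the empty set. -/
def clearBody : Prog :=
  .seq (.storeZ 1 (.reg 4) (.const (-1))) (.storeZ 2 (.reg 4) (.const (-1)))

theorem runs_clear (s : State) {n : ℕ} (hn : s.ireg 0 = n) :
    Runs (.forI 4 0 clearBody) s (n * 15 + 6) fun s' => Keep 4 6 2 1 s s' ∧
      ∀ i < n, s'.zarr 1 i = -1 ∧ s'.zarr 2 i = -1 := by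
  refine Runs.forI (T := 8) (Inv := fun k s' => Keep 4 6 2 1 s s' ∧
      ∀ i < k, s'.zarr 1 i = -1 ∧ s'.zarr 2 i = -1)
    s (by omega) hn ⟨keep_update_ireg s le_rfl, fun e he => absurd he (by omega)⟩
    fun k s' hk h4 h1 ⟨hK, hI⟩ => ?_
  refine Prog.LoopFree.runs (by simp [clearBody, Prog.LoopFree]) ?_ ?_
  · simp [clearBody, Prog.time, IExp.cost, ZExp.cost, bitCost_neg_one]
  simp only [clearBody, Prog.eval_seq, Prog.eval_storeZ, IExp.val, ZExp.val, h4]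
  refine ⟨by simp, by simp [h1], ?_, fun i hi => ?_⟩
  · exact (hK.trans ((keep_update_zarr _ (x := 1) (by omega)).trans
      (keep_update_zarr _ (x := 2) (by omega)))).trans (keep_update_ireg _ (x := 4) (by omega))
  · by_cases hik : i = k
    · simp [hik]
    · simpa [hik] using hI i (by omega)

/-- A loop that writes the values `c 0, …, c (n - 1)` to the index array `a`. -/
theorem runs_fill {s : State} {n a T : ℕ} {body : Prog} {c : ℕ → ℕ} (hl : body.LoopFree)
    (hn : s.ireg 0 = n)
    (hbody : ∀ k s', k < n → s'.ireg 4 = k → (∀ b ≠ a, s'.iarr b = s.iarr b) →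
      s'.zarr = s.zarr → body.time s' ≤ T ∧ body.eval s' =
        { s' with iarr := update s'.iarr a (update (s'.iarr a) k (c k)) }) :
    Runs (.forI 4 0 body) s (n * (T + 7) + 6) fun s' => Keep 4 a 2 1 s s' ∧
      ∀ i < n, s'.iarr a i = c i := by
  refine (Runs.forI (Inv := fun k s' => ((∀ x < 4, s'.ireg x = s.ireg x) ∧
      (∀ b ≠ a, s'.iarr b = s.iarr b) ∧ s'.zreg = s.zreg ∧ s'.zarr = s.zarr) ∧
      ∀ i < k, s'.iarr a i = c i) s (by omega) hn
    ⟨⟨fun x hx => by simp [show x ≠ 4 by omega], fun _ _ => rfl, rfl, rfl⟩,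
      fun e he => absurd he (by omega)⟩
    fun k s' hk h4 h1 ⟨⟨k1, k2, k3, k4⟩, hI⟩ => ?_).mono le_rfl
    fun s' ⟨⟨k1, k2, k3, k4⟩, h⟩ => ⟨⟨k1, fun b hb => k2 b (by omega),
      fun _ _ => congrFun k3 _, fun _ _ => congrFun k4 _⟩, h⟩
  obtain ⟨ht, he⟩ := hbody k s' hk h4 k2 k4
  refine hl.runs ht ?_
  rw [he]
  refine ⟨h4, h1, ⟨fun x hx => ?_, fun b hb => ?_, k3, k4⟩, fun i hi => ?_⟩
  · simpa [show x ≠ 4 by omega] using k1 x hx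
  · simpa [hb] using k2 b hb
  · by_cases hik : i = k
    · simp [hik]
    · simpa [hik] using hI i (by omega)

/-- Decide whether the current vertex, without debt, has a nonnegative value, and write the result
to the array 5. -/
def testBody : Prog :=
  .ite (.zle (.const 0) (.arr 1 (.reg 4))) (.storeI 5 (.reg 4) (.const 1))
    (.storeI 5 (.reg 4) (.const 0))

/-- Replace the set `X` in the array 5 by `forceSet U lam Z X`, where `Z` is in the array 4. -/
def innerProg : Prog :=
  .seq (.forI 4 0 clearBody) (.seq (.downZ 1 0 levelProg) (.forI 4 0 testBody))

open Classical in
theorem runs_inner [Finite V] {X Z : Set V} {B : ℕ}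
    (hs : Keep 2 4 1 1 (input G U lam ev ee) s) (hX : Indicates ev s 5 X)
    (hZ : Indicates ev s 4 Z) (hXZ : X ⊆ Z) (hlam : 1 ≤ lam) (hB : 2 ≤ B)
    (hbits : ∀ z : ℤ, z.natAbs ≤ 2 * (lam * G.maxWeight) → bitCost z ≤ B) [Nonempty V] :
    Runs innerProg s (150 * (lam * (Nat.card V + G.E.ncard) * B)) fun s' =>
      Keep 4 5 1 1 s s' ∧ Indicates ev s' 5 (G.forceSet U lam Z X) := by
  have hn : s.ireg 0 = Nat.card V := hs.1 0 (by omega)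
  have hW : lam * 1 ≤ lam * G.maxWeight := Nat.mul_le_mul_left _ Game.one_le_maxWeight
  refine ((runs_clear s hn).seq (T' := lam * ((Nat.card V + G.E.ncard) * (108 * B) + 5 * B + 5) +
    3 * B + 5 + (Nat.card V * (B + 7 + 7) + 6)) (Q' := fun s' =>
      Keep 4 5 1 1 s s' ∧ Indicates ev s' 5 (G.forceSet U lam Z X)) ?_).mono ?_ fun _ h => h
  · rintro s₁ ⟨hK₁, hc⟩
    have hval : Values G U ev X Z 0 s₁ := by
      have hW1 := Game.one_le_maxWeight (G := G)
      have hc' := fun v => hc (ev.symm v) (Fin.is_lt _)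
      constructor <;> intro v
      · rw [(hc' v).1]
        exact fun d => ⟨fun h => h.elim, fun h => by omega⟩
      · rw [(hc' v).2]
        exact fun d => ⟨fun h => h.elim, fun h => by omega⟩
      · rw [(hc' v).1]; omega
      · rw [(hc' v).2]; omega
    refine (Runs.downZ (B := B) (Inv := fun k s' => Keep 4 6 1 1 s s' ∧ Values G U ev X Z k s')
      s₁ ((hK₁.2.2.1 0 (by omega)).trans (hs.2.2.1 0 (by omega)))
      (fun k hk => hbits _ (by simp only [Int.natAbs_natCast]; omega)) hB
      ⟨hK₁.weaken.trans (keep_update_zreg _ le_rfl), ⟨hval.1, hval.2, hval.3, hval.4⟩⟩ ?_).seq ?_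
    · rintro k s₂ hk hz ⟨hK₂, hv₂⟩
      have hs₂ := hs.trans hK₂.weaken
      refine (runs_level_values hv₂ hs₂ (hX.congr (hK₂.2.1 5 (by omega)))
        (hZ.congr (hK₂.2.1 4 (by omega))) hXZ hlam hk.le hB hbits).mono le_rfl ?_
      rintro s₃ ⟨hK₃, hv₃⟩
      exact ⟨(hK₃.2.2.1 1 (by omega)).trans hz,
        (hK₂.trans hK₃.weaken).trans (keep_update_zreg _ le_rfl), ⟨hv₃.1, hv₃.2, hv₃.3, hv₃.4⟩⟩
    · rintro s₂ ⟨hK₂, hv₂⟩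
      refine (runs_fill (T := B + 7) (a := 5) (body := testBody)
        (c := fun k => if 0 ≤ s₂.zarr 1 k then 1 else 0)
        (by simp [testBody, Prog.LoopFree]) ((hK₂.1 0 (by omega)).trans hn) ?_).mono le_rfl ?_
      · intro k s₃ hk h4 _ hz
        constructor
        · refine (Prog.time_ite_le (T := 3) le_rfl le_rfl).trans ?_
          have := (hv₂.codes₀ (ev ⟨k, hk⟩)).natAbs_le (hv₂.neg_le₀ _) hlam le_rfl
          have := hbits (s₂.zarr 1 k) (by simp at this; omega)
          simp [Test.cost, ZExp.cost, IExp.cost, IExp.val, h4, hz,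
            show bitCost 0 = 1 by simp [bitCost]]
          omega
        · by_cases h0 : 0 ≤ s₂.zarr 1 k <;>
          simp [testBody, Prog.eval_ite_of_holds, Prog.eval_ite_of_not_holds, Prog.eval_storeI,
            Test.holds, IExp.val, ZExp.val, h4, hz, h0]
      · rintro s₃ ⟨hK₃, hc₃⟩
        refine ⟨hK₂.weaken.trans hK₃.weaken, fun v => ?_⟩
        have h1 := hc₃ (ev.symm v) (Fin.is_lt _)
        have h2 : v ∈ G.forceSet U lam Z X ↔ 0 ≤ s₂.zarr 1 (ev.symm v) := hv₂.codes₀ v 0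
        rw [h1, h2]
        exact ⟨fun h => if_pos h, fun h => if_neg h⟩
  · have hn1 : 1 ≤ Nat.card V := Nat.card_pos
    set K := Nat.card V + G.E.ncard with hK
    have hnK : Nat.card V ≤ K := Nat.le_add_right _ _
    have g1 : lam * 1 * B ≤ lam * K * B := by gcongr; omega
    have g2 : 1 * Nat.card V * B ≤ lam * K * B := by gcongr
    have g3 : 1 * 1 * 2 ≤ lam * K * B := by gcongr; omega
    have g4 : lam * 1 * 2 ≤ lam * K * B := by gcongr; omega
    have g5 : 1 * 1 * B ≤ lam * K * B := by gcongr; omega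
    have g6 : 1 * Nat.card V * 2 ≤ lam * K * B := by gcongr
    nlinarith

/-- Compute the least fixed point of `X ↦ forceSet U lam Z X` in the array 5, where `Z` is in the
array 4, and replace `Z` by it. -/
def outerProg : Prog :=
  .seq (.forI 4 0 (.storeI 5 (.reg 4) (.const 0)))
    (.seq (.forI 3 0 innerProg) (.forI 4 0 (.storeI 4 (.reg 4) (.arr 5 (.reg 4)))))

/-- The program for the winning set of player 1. -/
def winProg : Prog :=
  .seq (.forI 4 0 (.storeI 4 (.reg 4) (.const 1))) (.forI 2 0 outerProg)

theorem runs_outer [Finite V] {B k : ℕ}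
    (hs : Keep 2 4 1 1 (input G U lam ev ee) s) (hZ : Indicates ev s 4 (G.outer U lam k))
    (hlam : 1 ≤ lam) (hB : 2 ≤ B)
    (hbits : ∀ z : ℤ, z.natAbs ≤ 2 * (lam * G.maxWeight) → bitCost z ≤ B) [Nonempty V] :
    Runs outerProg s (200 * (Nat.card V * (lam * (Nat.card V + G.E.ncard) * B))) fun s' =>
      Keep 3 4 1 1 s s' ∧ Indicates ev s' 4 (G.outer U lam (k + 1)) := by
  have hn : s.ireg 0 = Nat.card V := hs.1 0 (by omega)
  refine ((runs_fill (T := 3) (a := 5) (c := fun _ => 0) (by simp [Prog.LoopFree]) hn ?_).seq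
    (T' := (Nat.card V * (150 * (lam * (Nat.card V + G.E.ncard) * B) + 7) + 6) +
      (Nat.card V * (4 + 7) + 6)) (Q' := fun s' =>
      Keep 3 4 1 1 s s' ∧ Indicates ev s' 4 (G.outer U lam (k + 1))) ?_).mono ?_ fun _ h => h
  · intro i s' _ h4 _ _
    exact ⟨le_rfl, by simp [Prog.eval_storeI, IExp.val, h4]⟩
  · rintro s₁ ⟨hK₁, hc⟩
    refine (Runs.forI (Inv := fun j s' => Keep 3 5 1 1 s s' ∧
        Indicates ev s' 5 (G.inner U lam (G.outer U lam k) j)) s₁ (by omega)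
        ((hK₁.1 0 (by omega)).trans hn) ⟨hK₁.weaken.trans (keep_update_ireg _ le_rfl), fun v =>
          ⟨fun h => h.elim, fun _ => hc _ (Fin.is_lt _)⟩⟩ ?_).seq ?_
    · rintro j s₂ hj h3 h0 ⟨hK₂, hX₂⟩
      refine (runs_inner (hs.trans hK₂.weaken) hX₂ (hZ.congr (hK₂.2.1 4 (by omega)))
        (Game.inner_subset_outer j k) hlam hB hbits).mono le_rfl ?_
      rintro s₃ ⟨hK₃, hX₃⟩
      exact ⟨(hK₃.1 3 (by omega)).trans h3, (hK₃.1 0 (by omega)).trans h0,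
        (hK₂.trans hK₃.weaken).trans (keep_update_ireg _ le_rfl), hX₃⟩
    · rintro s₂ ⟨hK₂, hX₂⟩
      refine (runs_fill (T := 4) (a := 4) (c := fun i => s₂.iarr 5 i) (by simp [Prog.LoopFree])
        ((hK₂.1 0 (by omega)).trans hn) ?_).mono le_rfl ?_
      · intro i s' _ h4 hb _
        exact ⟨le_rfl, by simp [Prog.eval_storeI, IExp.val, h4, hb 5 (by omega)]⟩
      · rintro s₃ ⟨hK₃, hc₃⟩
        refine ⟨hK₂.weaken.trans hK₃.weaken, fun v => ?_⟩
        rw [hc₃ _ (Fin.is_lt _)]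
        exact hX₂ v
  · have hn1 : 1 ≤ Nat.card V := Nat.card_pos
    have hp : 1 * 1 * 2 ≤ lam * (Nat.card V + G.E.ncard) * B := by gcongr; omega
    set p := lam * (Nat.card V + G.E.ncard) * B
    have g1 : Nat.card V * 2 ≤ Nat.card V * p := by gcongr
    nlinarith

theorem runs_win [Finite V] {B : ℕ} (hlam : 1 ≤ lam) (hB : 2 ≤ B)
    (hbits : ∀ z : ℤ, z.natAbs ≤ 2 * (lam * G.maxWeight) → bitCost z ≤ B) [Nonempty V] :
    Runs winProg (input G U lam ev ee)
      (240 * (Nat.card V ^ 2 * (lam * (Nat.card V + G.E.ncard) * B))) fun s' =>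
      Indicates ev s' 4 (G.winSet U lam) := by
  refine ((runs_fill (n := Nat.card V) (T := 3) (a := 4) (c := fun _ => 1)
    (by simp [Prog.LoopFree]) rfl ?_).seq
    (T' := Nat.card V * (200 * (Nat.card V * (lam * (Nat.card V + G.E.ncard) * B)) + 7) + 6)
    (Q' := fun s' => Indicates ev s' 4 (G.winSet U lam)) ?_).mono ?_ fun _ h => h
  · intro i s' _ h4 _ _
    exact ⟨le_rfl, by simp [Prog.eval_storeI, IExp.val, h4]⟩
  · rintro s₁ ⟨hK₁, hc⟩
    refine (Runs.forI (Inv := fun k s' => Keep 2 4 1 1 (input G U lam ev ee) s' ∧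
        Indicates ev s' 4 (G.outer U lam k)) s₁ (by omega) (hK₁.1 0 (by omega))
        ⟨hK₁.weaken.trans (keep_update_ireg _ le_rfl), fun v =>
          ⟨fun _ => hc _ (Fin.is_lt _), fun h => absurd trivial h⟩⟩ ?_).mono le_rfl
        fun s' h => h.2
    rintro k s₂ hk h2 h0 ⟨hK₂, hZ₂⟩
    refine (runs_outer hK₂ hZ₂ hlam hB hbits).mono le_rfl ?_
    rintro s₃ ⟨hK₃, hZ₃⟩
    exact ⟨(hK₃.1 2 (by omega)).trans h2, (hK₃.1 0 (by omega)).trans h0,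
      (hK₂.trans hK₃.weaken).trans (keep_update_ireg _ le_rfl), hZ₃⟩
  · have hn1 : 1 ≤ Nat.card V := Nat.card_pos
    have hp : 1 * 1 * 2 ≤ lam * (Nat.card V + G.E.ncard) * B := by gcongr; omega
    set p := lam * (Nat.card V + G.E.ncard) * B
    have g1 : Nat.card V * 2 ≤ Nat.card V * p := by gcongr
    have g2 : 1 * (Nat.card V * p) ≤ Nat.card V * (Nat.card V * p) := by gcongr
    nlinarith

theorem computes_winSet [Finite V] [Nonempty V] (G : Game V) (U : Set V) {lam : ℕ}
    (hlam : 1 ≤ lam) :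
    Computes winProg G U lam (G.winSet U lam)
      (960 * (lam * Nat.card V ^ 2 * (Nat.card V + G.E.ncard) *
        max 1 (Nat.clog 2 (lam * G.maxWeight)))) := by
  intro ev ee
  set N := lam * G.maxWeight with hN
  -- all numbers have absolute value at most `2 * N ≤ 2 ^ (clog N + 1)`
  have hbits : ∀ z : ℤ, z.natAbs ≤ 2 * N → bitCost z ≤ Nat.clog 2 N + 3 := by
    intro z hz
    have h1 : N ≤ 2 ^ Nat.clog 2 N := Nat.le_pow_clog (by omega) N
    have h2 : 0 < 2 ^ Nat.clog 2 N := by positivity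
    have h3 : z.natAbs < 2 ^ (Nat.clog 2 N + 2) := by rw [pow_add]; omega
    have := Nat.size_le.2 h3
    rw [bitCost]; omega
  obtain ⟨s', t, he, ht, hI⟩ := runs_win (G := G) (U := U) (ev := ev) (ee := ee) hlam
    (by omega) hbits
  refine ⟨s', t, he, ht.trans ?_, fun i => by simpa using hI (ev i)⟩
  have : Nat.clog 2 N + 3 ≤ 4 * max 1 (Nat.clog 2 N) := by omega
  calc 240 * (Nat.card V ^ 2 * (lam * (Nat.card V + G.E.ncard) * (Nat.clog 2 N + 3)))
      ≤ 240 * (Nat.card V ^ 2 * (lam * (Nat.card V + G.E.ncard) *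
          (4 * max 1 (Nat.clog 2 N)))) := by gcongr
    _ = _ := by ring

end Ram

/-! ### The iteration, its complexity, and the memory of the players -/

theorem mainTheorem8 :
    ∃ (P : Ram.Prog) (C : ℕ), ∀ (V : Type*) [Finite V] [Nonempty V] (G : Game V) (U : Set V)
      (lam : ℕ), 1 ≤ lam →
      -- the iteration stops after at most `|V|` rounds with the winning sets of both players
      (∃ k ≤ Nat.card V, G.Stops U lam k ∧ (∀ j < k, ¬ G.Stops U lam j) ∧
        G.candidate U lam k = G.Win₁ (G.WMP lam 0 ∩ G.Buchi U) ∧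
        (G.candidate U lam k)ᶜ = G.Win₂ (G.WMP lam 0 ∩ G.Buchi U)) ∧
      -- running time
      Ram.Computes P G U lam (G.Win₁ (G.WMP lam 0 ∩ G.Buchi U))
        (C * (lam * Nat.card V ^ 2 * (Nat.card V + G.E.ncard) *
          max 1 (Nat.clog 2 (lam * G.maxWeight)))) ∧
      -- memory of player 1
      (∀ v ∈ G.Win₁ (G.WMP lam 0 ∩ G.Buchi U), ∃ σ₁ : G.Strategy .one,
        G.Wins₁ (G.WMP lam 0 ∩ G.Buchi U) v σ₁ ∧
        σ₁.HasMemory (C * (lam ^ 2 * G.maxWeight * Nat.card V))) ∧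
      -- memory of player 2
      (∀ v ∈ G.Win₂ (G.WMP lam 0 ∩ G.Buchi U), ∃ σ₂ : G.Strategy .two,
        G.Wins₂ (G.WMP lam 0 ∩ G.Buchi U) v σ₂ ∧
        σ₂.HasMemory (C * (lam ^ 2 * G.maxWeight * Nat.card V ^ 2))) := by
  refine ⟨Ram.winProg, 960, fun V _ _ G U lam hlam => ⟨?_, ?_, ?_, ?_⟩⟩
  · obtain ⟨k, hk, hs, hmin⟩ := Game.exists_first_stop (G := G) U lam
    have h := Game.candidate_eq_winSet_of_stops hlam hs
    exact ⟨k, hk, hs, hmin, by rw [h, Game.win₁_eq_winSet hlam],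
      by rw [h, Game.win₂_eq_compl_winSet hlam]⟩
  · rw [Game.win₁_eq_winSet hlam]
    exact Ram.computes_winSet G U hlam
  · intro v hv
    rw [Game.win₁_eq_winSet hlam] at hv
    obtain ⟨σ, hm, hσ⟩ := Game.exists_strategy_one hlam hv
    exact ⟨σ, fun σ₂ => hσ _ (Game.follows_out_one v σ σ₂),
      hm.mono (Nat.mul_le_mul_right _ (by omega))⟩
  · intro v hv
    rw [Game.win₂_eq_compl_winSet hlam] at hv
    obtain ⟨σ, hm, hσ⟩ := Game.exists_strategy_two_of_not_mem hlam hv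
    exact ⟨σ, hσ, hm.mono (Nat.mul_le_mul_right _ (by omega))⟩
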